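/- **Conventions.** For a field $K\supseteq\mathbb F_2(T)$ let $\mathcal O_K$ be the integral closure of $\mathbb F_2[T]$ in $K$. An extension $K/F$ of such fields is *unramified at finite places* if every nonzero prime of $\mathcal O_K$ is unramified over $\mathcal O_F$. If $K/\mathbb F_2(T)$ is finite separable, the *splitting type* of a nonzero prime $\mathfrak p$ of $\mathbb F_2[T]$ in $K$ is the increasing list of the inertia degrees of the primes of $\mathcal O_K$ above $\mathfrak p$. *Lifted Goss zeta function.* Let $\mathbb C_\infty$ be the completion of an algebraic closure of $\mathbb F_2((1/T))$, with the extended absolute value $\|\cdot\|_\infty$, and $S_\infty=\mathbb C_\infty^{*}\times\mathbb Z_2$, with $-(x,y)=(x^{-1},-y)$. For $f\in\mathbb F_2[T]$ monic and $s=(x,y)\in S_\infty$ put $f^{s}=x^{\deg f}\langle f\rangle^{y}$, where $\langle f\rangle=f/T^{\deg f}$. Let $\chi:\mathbb C_\infty\to W(\mathbb C_\infty)$ be the Teichmüller character. The ring $W(\mathbb C_\infty)$ of Witt vectors carries the weak topology: a fundamental system of neighbourhoods of $0$ is given by the sets $\{(x_n)_n : x_0,\dots,x_m\in I\}$, with $I$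 an open ideal of $\{z\in\mathbb C_\infty:\|z\|_\infty\le 1\}$ and $m\ge 0$. The norm $N(I)\in\mathbb F_2[T]$ of a nonzero ideal $I$ of $\mathcal O_K$ is the multiplicative function such that $N(\mathfrak P)=f^{d}$ for a nonzero prime $\mathfrak P$, where $f$ is the monic generator of $\mathfrak P\cap\mathbb F_2[T]$ and $d$ is the inertia degree of $\mathfrak P$. Then $$\zeta^{[0]}_{K/\mathbb F_2(T)}(s)=\sum_{0\neq I\subseteq\mathcal O_K}\chi\bigl(N(I)^{-s}\bigr)\in W(\mathbb C_\infty),\qquad s=(x,y)\in S_\infty,\ \|x\|_\infty>1 .$$ *The fields.* For a prime number $p\ge 2$, choose $\zeta,\alpha,\theta,\theta'$ in an algebraic closure of $\mathbb F_2(T)$ with $$\zeta^2+\zeta+1=0,\quad \alpha^2+\alpha+\zeta T=0,\quad \theta^2+\theta+(T^2+\zeta T)\alpha+T^p=0,\quad \theta'^2+\theta'+(T^2+\zeta T)\alpha+T^p+T^3=0,$$ and let $K(p)=\mathbb F_2(T)(\zeta,\alpha,\theta)$ and $K'(p)=\mathbb F_2(T)(\zeta,\alpha,\theta')$; the assertions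 below hold for every choice of roots, made independently for the two fields. Let $N(p)$ be the Galois closure of $K(p)$ over $\mathbb F_2(T)$. **Statement.** 1. Let $F$ be a finite separable extension of $\mathbb F_2(T)$ and $K=F(a)$ with $a^2+a+c=0$ for some $c\in\mathcal O_F$. Then $K/F$ is unramified at finite places. 2. Let $K_1\subseteq K_2\subseteq\dots\subseteq K_n$ be a tower with $K_1$ finite separable over $\mathbb F_2(T)$ and $K_{i+1}=K_i(a_i)$, where $a_i^2+a_i+c_i=0$ for some $c_i\in\mathcal O_{K_i}$. Then $K_n/K_1$ is unramified at finite places. 3. For every prime number $p$, the extension $N(p)/\mathbb F_2(T)$ is Galois and unramified at finite places. 4. For every prime number $p$, the extensions $K(p)$ and $K'(p)$ of $\mathbb F_2(T)$ are finite separable and arithmetically equivalent with no exceptions: every nonzero prime of $\mathbb F_2[T]$ has the same splitting type in $K(p)$ and in $K'(p)$. 5. For every prime number $p$ the series defining $\zeta^{[0]}_{K(p)/\mathbb F_2(T)}(s)$ and $\zeta^{[0]}_{K'(p)/\mathbb F_2(T)}(s)$ converge for all $s=(x,y)\in S_\infty$ with $\|x\|_\infty>1$, and $$\zeta^{[0]}_{K(p)/\mathbb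 F_2(T)}(s)=\zeta^{[0]}_{K'(p)/\mathbb F_2(T)}(s).$$ -/

import Mathlib

open scoped Polynomial RatFunc NNReal WithZero

noncomputable section

namespace GossZeta

/-- The completion `𝔽₂((1/T))` of `𝔽₂(T)` at the place at infinity. -/
abbrev FInfty : Type := @RatFunc.CompletionAtInfty (ZMod 2) _ (Classical.decEq _)

instance : CompleteSpace FInfty :=
  letI := Classical.decEq (ZMod 2)⟮X⟯
  letI : UniformSpace (ZMod 2)⟮X⟯ := (RatFunc.inftyValued (ZMod 2)).toUniformSpace
  inferInstanceAs (CompleteSpace (UniformSpace.Completion (ZMod 2)⟮X⟯))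

/-- The valuation of the image of `T`, computed in the completion. -/
theorem v_T : (Valued.v (algebraMap (ZMod 2)⟮X⟯ FInfty RatFunc.X) : ℤᵐ⁰) = WithZero.exp 1 := by
  let _ := Classical.decEq (ZMod 2)⟮X⟯
  let _ := RatFunc.inftyValued (ZMod 2)
  exact (Valued.extensionValuation_apply_coe (K := (ZMod 2)⟮X⟯) RatFunc.X).trans
    (RatFunc.inftyValuation.X (ZMod 2))

/-- The absolute value `‖·‖_∞` on `𝔽₂((1/T))` is normalised by `‖T‖_∞ = 2`. -/
instance : (Valued.v : Valuation FInfty ℤᵐ⁰).RankOne where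
  hom' := (WithZeroMulInt.toNNReal (e := 2) two_ne_zero).comp
    MonoidWithZeroHom.ValueGroup₀.embedding
  strictMono' := (WithZeroMulInt.toNNReal_strictMono (e := 2) one_lt_two).comp
    MonoidWithZeroHom.ValueGroup₀.embedding_strictMono
  exists_val_nontrivial := ⟨algebraMap (ZMod 2)⟮X⟯ FInfty RatFunc.X, by
    rw [v_T]; simp⟩

instance : NontriviallyNormedField FInfty := Valued.toNontriviallyNormedField FInfty ℤᵐ⁰

instance : IsUltrametricDist FInfty :=
  IsUltrametricDist.isUltrametricDist_of_forall_norm_add_le_max_norm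
    (Valued.isNonarchimedean_norm FInfty ℤᵐ⁰)

/-- The algebraic closure of `𝔽₂((1/T))`, normed by the unique extension of `‖·‖_∞`. -/
abbrev FInftyAlgCl : Type := AlgebraicClosure FInfty

instance : NormedField FInftyAlgCl := spectralNorm.normedField FInfty FInftyAlgCl

instance : NormedAlgebra FInfty FInftyAlgCl := spectralNorm.normedAlgebra _ _

instance : IsUltrametricDist FInftyAlgCl :=
  IsUltrametricDist.isUltrametricDist_of_forall_norm_add_le_max_norm
    (isNonarchimedean_spectralNorm (K := FInfty) (L := FInftyAlgCl))

instance : UniformContinuousConstSMul FInfty FInftyAlgCl :=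
  uniformContinuousConstSMul_of_continuousConstSMul _ _

/-- The completion of the algebraic closure of `𝔽₂((1/T))`. -/
abbrev CInfty : Type := UniformSpace.Completion FInftyAlgCl

instance : NormedField CInfty := inferInstance

instance : IsUltrametricDist CInfty := IsUltrametricDist.of_normedAlgebra FInfty

/-- The valuation ring `{z : ‖z‖_∞ ≤ 1}` of `CInfty`. -/
abbrev CInftyInt : Subring CInfty := (NormedField.valuation (K := CInfty)).integer

/-- The group `S_∞ = ℂ_∞ˣ × ℤ₂`, written additively, so that `-(x, y) = (x⁻¹, -y)`. -/
abbrev SInfty : Type := Additive CInftyˣ × ℤ_[2]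

/-- The first coordinate `x` of `s = (x, y)`. -/
def SInfty.x (s : SInfty) : CInfty := ((Additive.toMul s.1 : CInftyˣ) : CInfty)

/-- The `1`-unit `⟨f⟩ = f / T ^ deg f` attached to a monic polynomial `f`. -/
def oneUnit (f : (ZMod 2)[X]) : CInfty :=
  algebraMap FInfty CInfty (algebraMap (ZMod 2)⟮X⟯ FInfty
    (algebraMap (ZMod 2)[X] (ZMod 2)⟮X⟯ f / RatFunc.X ^ f.natDegree))

/-- `⟨f⟩ ^ y` for a `2`-adic integer `y = ∑ aᵢ 2ⁱ` with `aᵢ ∈ {0, 1}`: the limit of the finite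
products `∏_{i < n} (⟨f⟩ ^ (2 ^ i)) ^ aᵢ`. Here `y.appr n = ∑_{i < n} aᵢ 2ⁱ`. -/
def oneUnitPow (f : (ZMod 2)[X]) (y : ℤ_[2]) : CInfty :=
  Filter.limUnder Filter.atTop fun n : ℕ => oneUnit f ^ y.appr n

/-- Goss's exponentiation `f ^ s = x ^ deg f * ⟨f⟩ ^ y` for monic `f` and `s = (x, y)`. -/
def gossPow (f : (ZMod 2)[X]) (s : SInfty) : CInfty :=
  s.x ^ f.natDegree * oneUnitPow f s.2

/-- The Witt vectors of `ℂ_∞`. -/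
abbrev W : Type := WittVector 2 CInfty

/-- The set of Witt vectors whose components `x₀, …, x_m` lie in the ideal `I`. -/
def wittNhd (I : Ideal CInftyInt) (m : ℕ) : Set W :=
  {w | ∀ i ≤ m, ∃ z ∈ I, (z : CInfty) = w.coeff i}

/-- The weak topology on `W`: the translation-invariant topology for which the sets `wittNhd I m`,
with `I` an open ideal of the valuation ring, form a fundamental system of neighbourhoods of `0`. -/
instance : TopologicalSpace W where
  IsOpen U := ∀ a ∈ U, ∃ (I : Ideal CInftyInt) (m : ℕ),
    IsOpen (I : Set CInftyInt) ∧ ∀ v ∈ wittNhd I m, a + v ∈ U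
  isOpen_univ := fun _ _ => ⟨⊤, 0, by simp, fun _ _ => trivial⟩
  isOpen_inter := by
    intro U V hU hV a ha
    obtain ⟨I, m, hI, h⟩ := hU a ha.1
    obtain ⟨J, n, hJ, h'⟩ := hV a ha.2
    refine ⟨I ⊓ J, max m n, hI.inter hJ, fun v hv => ⟨h v ?_, h' v ?_⟩⟩
    · intro i hi
      obtain ⟨z, hz, e⟩ := hv i (hi.trans (le_max_left _ _))
      exact ⟨z, hz.1, e⟩
    · intro i hi
      obtain ⟨z, hz, e⟩ := hv i (hi.trans (le_max_right _ _))
      exact ⟨z, hz.2, e⟩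
  isOpen_sUnion := by
    intro S hS a ⟨U, hU, ha⟩
    obtain ⟨I, m, hI, h⟩ := hS U hU a ha
    exact ⟨I, m, hI, fun v hv => ⟨U, hU, h v hv⟩⟩

section FunctionFields

/-- The integral closure `𝓞_K` of `𝔽₂[T]` in a field `K` containing it. -/
abbrev OInt (K : Type*) [Field K] [Algebra (ZMod 2)[X] K] : Type _ :=
  FunctionField.ringOfIntegers (ZMod 2) K

/-- The element `T` of an extension of `𝔽₂(T)`. -/
def T (K : Type*) [Field K] [Algebra (ZMod 2)[X] K] : K :=
  algebraMap (ZMod 2)[X] K Polynomial.X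

/-- `K / F` is unramified at the finite places: every nonzero prime of `𝓞_K` is unramified
over `𝓞_F`. -/
def UnramifiedAtFinitePlaces (F K : Type*) [Field F] [Field K] [Algebra (ZMod 2)[X] F]
    [Algebra (ZMod 2)[X] K] [Algebra F K] [IsScalarTower (ZMod 2)[X] F K] : Prop :=
  letI : Algebra (OInt F) (OInt K) :=
    (IsScalarTower.toAlgHom (ZMod 2)[X] F K).mapIntegralClosure.toRingHom.toAlgebra
  ∀ (P : Ideal (OInt K)) [P.IsPrime], P ≠ ⊥ → Algebra.IsUnramifiedAt (OInt F) P

variable (K : Type*) [Field K] [Algebra (ZMod 2)[X] K] [Algebra (ZMod 2)⟮X⟯ K]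
  [IsScalarTower (ZMod 2)[X] (ZMod 2)⟮X⟯ K]

/-- `K = 𝔽₂(T)(ζ, α, θ)` with `ζ² + ζ + 1 = 0`, `α² + α + ζT = 0` and
`θ² + θ + (T² + ζT)α + c(T) = 0`, where `T = T K` is the image of the variable. -/
def IsArtinSchreierTower (c : (ZMod 2)[X]) : Prop :=
  ∃ ζ α θ : K, ζ ^ 2 + ζ + 1 = 0 ∧ α ^ 2 + α + ζ * T K = 0 ∧
    θ ^ 2 + θ + (T K ^ 2 + ζ * T K) * α + algebraMap (ZMod 2)[X] K c = 0 ∧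
    IntermediateField.adjoin (ZMod 2)⟮X⟯ {ζ, α, θ} = ⊤

/-- `K` is (a model of) the field `K(p)`. -/
def IsK (p : ℕ) : Prop := IsArtinSchreierTower K (Polynomial.X ^ p)

/-- `K` is (a model of) the field `K'(p)`. -/
def IsK' (p : ℕ) : Prop := IsArtinSchreierTower K (Polynomial.X ^ p + Polynomial.X ^ 3)

variable [FunctionField (ZMod 2) K] [Algebra.IsSeparable (ZMod 2)⟮X⟯ K]

/-- The splitting type of a nonzero prime `𝔭` of `𝔽₂[T]` in `K`: the increasing list of the inertia
degrees of the primes of `𝓞_K` above `𝔭`. -/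
def splittingType (𝔭 : Ideal (ZMod 2)[X]) : List ℕ :=
  ((IsDedekindDomain.primesOverFinset 𝔭 (OInt K)).val.map
    fun P => P.inertiaDeg (ZMod 2)[X]).sort (· ≤ ·)

variable {K} in
/-- The norm `f ^ deg` of a nonzero prime `P` of `𝓞_K`, where `f` is the monic generator of
`P ∩ 𝔽₂[T]` and `deg` is the inertia degree. -/
def primeNorm (P : Ideal (OInt K)) : (ZMod 2)[X] :=
  normalize (Submodule.IsPrincipal.generator (P.under (ZMod 2)[X])) ^ P.inertiaDeg (ZMod 2)[X]

variable {K} in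
/-- The norm of a nonzero ideal of `𝓞_K`, extended multiplicatively from the primes. -/
def idealNorm (I : Ideal (OInt K)) : (ZMod 2)[X] :=
  ((UniqueFactorizationMonoid.normalizedFactors I).map primeNorm).prod

/-- The terms `χ(N(I)^{-s})` of the lifted Goss zeta function, `χ` being the Teichmüller
character. -/
def zetaTerm (s : SInfty) (I : {I : Ideal (OInt K) // I ≠ ⊥}) : W :=
  WittVector.teichmuller 2 (gossPow (idealNorm I.1) (-s))

/-- The lifted Goss zeta function of `K / 𝔽₂(T)`, a series over the nonzero ideals of `𝓞_K`
taken in the weak topology of `W`. -/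
def liftedGossZeta (s : SInfty) : W := ∑' I, zetaTerm K s I

end FunctionFields

end GossZeta

end

/-!
Write `A = 𝔽₂[T]`. The proof rests on three elementary facts.

*Artin-Schreier extensions with integral constant term.* If `a² + a + c = 0` with `c ∈ 𝓞_L`, then
`a` has trace `1` over `L` unless it lies in `L`, and `𝓞_{L(a)} = 𝓞_L + 𝓞_L a`
(`exists_isIntegral_eq_add_mul`). Differentiating the equation gives `da = -dc` in characteristic
two, so a derivation of the top ring of integers that vanishes on `𝓞_L` vanishes on `𝓞_{L(a)}`
(`DerivationVanishes.sup_adjoin`). Hence the module of differentials of a tower of such extensions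
is zero. The normal closure is generated by the images of `ζ, α, θ` under all embeddings, so it is
reached by such a tower too; the argument is phrased by taking a maximal intermediate field on which
derivations vanish.

*Points over finite fields.* The ring of integers of `K(p)` is `A[ζ][α][θ]`, free of rank eight
(`exists_isArtinSchreierStep`), so for a finite field `B` and `t ∈ B` its `A`-algebra homomorphisms
to `B` with `T ↦ t` are the solutions `(z, a, h)` in `B` of
`z² + z = 1`, `a² + a = z t`, `h² + h = (t² + z t) a + t ^ p`.
The numbers of these for all finite `B` determine the inertia degrees above every prime of `A`
(`card_algHom_eq_sum`, `inertiaDegs_eq_of_card_algHom`). For `K'(p)` the last equation has the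
additional term `t³`. The numbers of solutions agree because `{w² + w}` has index two in `B`: one
of `t³`, `t`, `t³ + t` has the form `w² + w`, and accordingly `(z, a, h)` is sent to a triple with
first two entries `(z, a)`, `(z + 1, a + w)` or `(z, a + 1)` (`card_towerSolutions_le`).

*The zeta function.* For monic `f` one has `‖f ^ (-s)‖ = ‖x‖ ^ (-deg f)`, and only finitely many
ideals have norm of bounded degree, so the terms are Teichmüller lifts of a null family. Such a
family is summable because a difference of Witt vectors over the valuation ring has its components
in an ideal `J` if and only if the components agree modulo `J` (`summable_teichmuller`).
Arithmetic equivalence gives a norm-preserving bijection between the nonzero ideals of the two rings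
of integers (`exists_equiv_ideal`), and the two sums are rearrangements of each other.
-/

namespace GossZeta

/-! ### Integral elements of Artin-Schreier extensions -/

section ArtinSchreier

variable {R F K : Type*} [CommRing R] [Field F] [Field K] [Algebra R F] [Algebra R K]
  [Algebra F K] [IsScalarTower R F K]

theorem isIntegral_artinSchreier {a c : K} (hc : IsIntegral R c) (h : a ^ 2 + a + c = 0) :
    IsIntegral R a := by
  have hac : IsIntegral (integralClosure R K) a := by
    refine ⟨Polynomial.X ^ 2 + (Polynomial.X + Polynomial.C ⟨c, hc⟩), ?_, ?_⟩
    · exact Polynomial.monic_X_pow_add (by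
        rw [Polynomial.degree_X_add_C]; norm_num)
    · simpa [← add_assoc] using h
  exact isIntegral_trans a hac

theorem exists_eq_add_mul_of_mem_adjoin (L : IntermediateField F K) {a c x : K} (hc : c ∈ L)
    (h : a ^ 2 + a + c = 0) (hx : x ∈ L ⊔ IntermediateField.adjoin F {a}) :
    ∃ u ∈ L, ∃ v ∈ L, x = u + v * a := by
  have ha : IsIntegral L a := isIntegral_artinSchreier (c := c)
    (isIntegral_algebraMap (R := L) (x := ⟨c, hc⟩)) h
  have hx' : x ∈ IntermediateField.adjoin L {a} := by
    rw [← IntermediateField.restrictScalars_adjoin_eq_sup] at hx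
    exact hx
  rw [← IntermediateField.mem_toSubalgebra,
    IntermediateField.adjoin_simple_toSubalgebra_of_isAlgebraic ha.isAlgebraic] at hx'
  obtain ⟨p, rfl⟩ := Algebra.adjoin_mem_exists_aeval L a hx'
  set q : L[X] := Polynomial.X ^ 2 + (Polynomial.X + Polynomial.C ⟨c, hc⟩) with hq
  have hdeg : (Polynomial.X + Polynomial.C (⟨c, hc⟩ : L)).degree < 2 := by
    rw [Polynomial.degree_X_add_C]; norm_num
  have hqm : q.Monic := Polynomial.monic_X_pow_add hdeg
  have hqa : Polynomial.aeval a q = 0 := by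
    simpa [hq, ← add_assoc] using h
  rw [← Polynomial.aeval_modByMonic_eq_self_of_root hqa]
  have hqd : q.natDegree = 2 := Polynomial.natDegree_eq_of_degree_eq_some
    (by rw [hq, Polynomial.degree_add_eq_left_of_degree_lt] <;> simp)
  have hd : (p %ₘ q).natDegree ≤ 1 := by
    have := Polynomial.natDegree_modByMonic_lt p hqm (by
      intro h1; rw [h1] at hqd; simp at hqd)
    omega
  obtain ⟨v, u, huv⟩ := Polynomial.exists_eq_X_add_C_of_natDegree_le_one hd
  refine ⟨u, u.2, v, v.2, ?_⟩
  rw [huv]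
  simp [add_comm]

/-- In other words `𝓞_{L(a)} = 𝓞_L + 𝓞_L a`. If `a ∉ L`, the trace of `u + v * a` over `L` is `v`, so
that `v` is integral as soon as `u + v * a` is. -/
theorem exists_isIntegral_eq_add_mul [CharP K 2] (L : IntermediateField F K) {a c x : K} (hc : c ∈ L)
    (hcR : IsIntegral R c) (h : a ^ 2 + a + c = 0) (hx : x ∈ L ⊔ IntermediateField.adjoin F {a})
    (hxR : IsIntegral R x) :
    ∃ u ∈ L, ∃ v ∈ L, IsIntegral R u ∧ IsIntegral R v ∧ x = u + v * a := by
  by_cases hxL : x ∈ L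
  · exact ⟨x, hxL, 0, L.zero_mem, hxR, isIntegral_zero, by simp⟩
  obtain ⟨u, hu, v, hv, rfl⟩ := exists_eq_add_mul_of_mem_adjoin L hc h hx
  suffices hvR : IsIntegral R v by
    refine ⟨u, hu, v, hv, ?_, hvR, rfl⟩
    simpa using hxR.sub (hvR.mul (isIntegral_artinSchreier hcR h))
  have hxL' : IsIntegral L (u + v * a) := (hxR.tower_top (A := F)).tower_top
  -- in characteristic `2`, the element `u + v * a` is a root of `X² + v X + (u² + u v + v² c)`
  set n : L := ⟨u, hu⟩ ^ 2 + ⟨u, hu⟩ * ⟨v, hv⟩ + ⟨v, hv⟩ ^ 2 * ⟨c, hc⟩ with hn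
  set q : L[X] := Polynomial.X ^ 2 + (Polynomial.C (⟨v, hv⟩ : L) * Polynomial.X +
    Polynomial.C n) with hq
  have hdeg : (Polynomial.C (⟨v, hv⟩ : L) * Polynomial.X + Polynomial.C n).degree < 2 :=
    Polynomial.degree_linear_le.trans_lt (by norm_num)
  have hqm : q.Monic := Polynomial.monic_X_pow_add hdeg
  have hqd : q.degree = 2 := by
    rw [hq, Polynomial.degree_add_eq_left_of_degree_lt] <;> simp [hdeg]
  have h2 : (2 : K) = 0 := CharTwo.two_eq_zero
  have hqx : Polynomial.aeval (u + v * a) q = 0 := by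
    simp only [hq, map_add, map_mul, map_pow, Polynomial.aeval_X, Polynomial.aeval_C]
    change (u + v * a) ^ 2 + (v * (u + v * a) + (u ^ 2 + u * v + v ^ 2 * c)) = 0
    linear_combination v ^ 2 * h + (u ^ 2 + u * v * a + u * v) * h2
  have hmin : minpoly L (u + v * a) = q := by
    refine (Polynomial.eq_of_monic_of_dvd_of_natDegree_le (minpoly.monic hxL') hqm
      (minpoly.dvd L _ hqx) ?_).symm
    rw [Polynomial.natDegree_eq_of_degree_eq_some hqd]
    by_contra! hlt
    refine hxL ?_
    have h1 : (minpoly L (u + v * a)).natDegree = 1 :=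
      le_antisymm (by omega) (minpoly.natDegree_pos hxL')
    have hb := minpoly.natDegree_eq_one_iff.mp h1
    obtain ⟨y, hy⟩ := hb
    rw [← hy]
    exact y.2
  have : IsScalarTower R L K := .of_algebraMap_eq fun r => rfl
  have hcoeff := Polynomial.isIntegral_coeff_of_dvd (S := L) (minpoly R (u + v * a))
    (minpoly L (u + v * a)) (minpoly.monic hxR) (minpoly.monic hxL')
    (minpoly.dvd_map_of_isScalarTower R L _) 1
  rw [hmin] at hcoeff
  have hc1 : q.coeff 1 = ⟨v, hv⟩ := by
    simp [hq, Polynomial.coeff_X_pow, Polynomial.coeff_C]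
  rw [hc1] at hcoeff
  exact hcoeff.map (IsScalarTower.toAlgHom R L K)

end ArtinSchreier

/-! ### Unramifiedness at the finite places -/

section Unramified

variable {F K : Type*} [Field F] [Field K] [Algebra (ZMod 2)[X] F] [Algebra (ZMod 2)[X] K]
  [Algebra F K] [IsScalarTower (ZMod 2)[X] F K]

theorem charP_two (K : Type*) [Field K] [Algebra (ZMod 2)[X] K] : CharP K 2 := by
  let _ : Algebra (ZMod 2) K := ((algebraMap (ZMod 2)[X] K).comp Polynomial.C).toAlgebra
  exact charP_of_injective_algebraMap (algebraMap (ZMod 2) K).injective 2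

variable (F K) in
/-- The inclusion `𝓞_F → 𝓞_K`. -/
noncomputable abbrev algebraOInt : Algebra (OInt F) (OInt K) :=
  (IsScalarTower.toAlgHom (ZMod 2)[X] F K).mapIntegralClosure.toRingHom.toAlgebra

/-- The universal `𝓞_F`-derivation of `𝓞_K`, and hence every other one, vanishes on the integral
elements of `L`. -/
def DerivationVanishes (L : IntermediateField F K) : Prop :=
  letI := algebraOInt F K
  ∀ x : OInt K, (x : K) ∈ L → KaehlerDifferential.D (OInt F) (OInt K) x = 0

theorem derivationVanishes_bot : DerivationVanishes (⊥ : IntermediateField F K) := by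
  let := algebraOInt F K
  rintro x hx
  obtain ⟨y, hy⟩ := IntermediateField.mem_bot.mp hx
  have hyi : IsIntegral (ZMod 2)[X] y := by
    have hx2 : IsIntegral (ZMod 2)[X] (x : K) := x.2
    rw [← hy] at hx2
    exact (isIntegral_algHom_iff (IsScalarTower.toAlgHom (ZMod 2)[X] F K)
      (algebraMap F K).injective).mp hx2
  have : x = algebraMap (OInt F) (OInt K) ⟨y, hyi⟩ := Subtype.ext hy.symm
  rw [this, Derivation.map_algebraMap]

/-- Differentiating `a² + a + c = 0` gives `da = -dc` in characteristic `2`. -/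
theorem derivation_eq_zero {A B M : Type*} [CommRing A] [CommRing B] [Algebra A B]
    [AddCommGroup M] [Module A M] [Module B M] (D : Derivation A B M) (h2 : (2 : B) = 0) {a c : B}
    (h : a ^ 2 + a + c = 0) (hc : D c = 0) : D a = 0 := by
  have e := congrArg D h
  rw [map_add, map_add, hc, sq, Derivation.leibniz, ← two_smul B, h2, zero_smul, zero_add,
    add_zero, map_zero] at e
  exact e

theorem DerivationVanishes.sup_adjoin {L : IntermediateField F K} (hL : DerivationVanishes L)
    {a c : K} (hc : c ∈ L) (hcR : IsIntegral (ZMod 2)[X] c) (h : a ^ 2 + a + c = 0) :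
    DerivationVanishes (L ⊔ IntermediateField.adjoin F {a}) := by
  let := algebraOInt F K
  have := charP_two K
  intro x hx
  obtain ⟨u, hu, v, hv, hui, hvi, hxe⟩ := exists_isIntegral_eq_add_mul L hc hcR h hx x.2
  have hai := isIntegral_artinSchreier hcR h
  let a' : OInt K := ⟨a, hai⟩
  have hD : KaehlerDifferential.D (OInt F) (OInt K) a' = 0 := by
    have e : a' ^ 2 + a' + ⟨c, hcR⟩ = 0 := Subtype.ext h
    have h2 : (2 : OInt K) = 0 := Subtype.ext (CharTwo.two_eq_zero (R := K))
    exact derivation_eq_zero _ h2 e (hL ⟨c, hcR⟩ hc)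
  have hx' : x = ⟨u, hui⟩ + ⟨v, hvi⟩ * a' := Subtype.ext hxe
  rw [hx', map_add, Derivation.leibniz, hL ⟨u, hui⟩ hu, hL ⟨v, hvi⟩ hv, hD]
  simp

theorem DerivationVanishes.unramified (h : DerivationVanishes (⊤ : IntermediateField F K)) :
    UnramifiedAtFinitePlaces F K := by
  let := algebraOInt F K
  intro P _ _
  have hsub : Algebra.FormallyUnramified (OInt F) (OInt K) := by
    refine ⟨?_⟩
    have hs := KaehlerDifferential.span_range_derivation (OInt F) (OInt K)
    rw [Submodule.span_eq_bot.mpr] at hs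
    · refine subsingleton_of_forall_eq 0 fun x => ?_
      rw [← Submodule.mem_bot (OInt K), hs]
      trivial
    · rintro _ ⟨x, rfl⟩
      exact h x trivial
  have : Algebra.FormallyUnramified (OInt K) (Localization.AtPrime P) :=
    .of_isLocalization P.primeCompl
  exact Algebra.FormallyUnramified.comp (OInt F) (OInt K) _

theorem unramified_of_tower {n : ℕ} {E : ℕ → IntermediateField F K} (h0 : E 0 = ⊥)
    (hn : E n = ⊤)
    (h : ∀ i < n, ∃ c ∈ E i, ∃ a : K, IsIntegral (ZMod 2)[X] c ∧ a ^ 2 + a + c = 0 ∧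
      E (i + 1) = E i ⊔ IntermediateField.adjoin F {a}) :
    UnramifiedAtFinitePlaces F K := by
  refine DerivationVanishes.unramified ?_
  have key : ∀ i ≤ n, DerivationVanishes (E i) := by
    intro i
    induction i with
    | zero => intro _; rw [h0]; exact derivationVanishes_bot
    | succ i ih =>
      intro hi
      obtain ⟨c, hc, a, hcR, hac, hE⟩ := h i hi
      rw [hE]
      exact (ih (by omega)).sup_adjoin hc hcR hac
  exact hn ▸ key n le_rfl

theorem unramified_of_artinSchreier {c : F} {a : K} (hc : IsIntegral (ZMod 2)[X] c)
    (h : a ^ 2 + a + algebraMap F K c = 0) (ha : IntermediateField.adjoin F {a} = ⊤) :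
    UnramifiedAtFinitePlaces F K := by
  refine DerivationVanishes.unramified ?_
  have := (derivationVanishes_bot (F := F) (K := K)).sup_adjoin
    (IntermediateField.algebraMap_mem _ c) (hc.map (IsScalarTower.toAlgHom (ZMod 2)[X] F K)) h
  rwa [ha, sup_top_eq] at this

/-- The intermediate field `L` contains every root `a ∈ K` of an Artin-Schreier equation
`a² + a + c = 0` whose constant term `c ∈ L` is integral. -/
def IsArtinSchreierClosed (L : IntermediateField F K) : Prop :=
  ∀ a c : K, c ∈ L → IsIntegral (ZMod 2)[X] c → a ^ 2 + a + c = 0 → a ∈ L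

/-- A maximal subextension on which derivations vanish is closed under all integral
Artin-Schreier extensions. -/
theorem unramified_of_forall_isArtinSchreierClosed [FiniteDimensional F K]
    (h : ∀ L : IntermediateField F K, IsArtinSchreierClosed L → L = ⊤) :
    UnramifiedAtFinitePlaces F K := by
  obtain ⟨L, hL, hmax⟩ := WellFounded.has_min
    (InvImage.wf (fun L : IntermediateField F K => L.toSubalgebra.toSubmodule) wellFounded_gt)
    {L | DerivationVanishes L} ⟨⊥, derivationVanishes_bot⟩
  refine DerivationVanishes.unramified ?_
  rw [← h L]
  · exact hL
  intro a c hc hcR hac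
  have h1 := hmax _ (hL.sup_adjoin hc hcR hac)
  have h2 : L = L ⊔ IntermediateField.adjoin F {a} := le_sup_left.eq_of_not_lt h1
  rw [h2]
  exact (le_sup_right : _ ≤ L ⊔ _) (IntermediateField.mem_adjoin_simple_self F a)

end Unramified

/-! ### The fields `K(p)` and `K'(p)` and their normal closures -/

theorem isIntegral_T {K : Type*} [Field K] [Algebra (ZMod 2)[X] K] :
    IsIntegral (ZMod 2)[X] (T K) := isIntegral_algebraMap

theorem isIntegral_of_sq_add_self {K : Type*} [Field K] [Algebra (ZMod 2)[X] K] {ζ : K}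
    (h : ζ ^ 2 + ζ + 1 = 0) : IsIntegral (ZMod 2)[X] ζ :=
  isIntegral_artinSchreier isIntegral_one h

theorem finiteDimensional_of_top {F E : Type*} [Field F] [Field E] [Algebra F E]
    (h : FiniteDimensional F (⊤ : IntermediateField F E)) : FiniteDimensional F E :=
  Module.Finite.equiv (IntermediateField.topEquiv (F := F) (E := E)).toLinearEquiv

theorem isArtinSchreierClosed_separableClosure (K : Type*) [Field K]
    [Algebra (ZMod 2)[X] K] [Algebra (ZMod 2)⟮X⟯ K] :
    IsArtinSchreierClosed (separableClosure (ZMod 2)⟮X⟯ K) := by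
  intro a c hc _ h
  have := charP_two K
  rw [mem_separableClosure_iff]
  refine IsSeparable.of_algebra_isSeparable_of_isSeparable (E := separableClosure (ZMod 2)⟮X⟯ K)
    _ ?_
  let q : (separableClosure (ZMod 2)⟮X⟯ K)[X] :=
    Polynomial.X ^ 2 + Polynomial.X + Polynomial.C ⟨c, hc⟩
  have hq : q.Separable := by
    have : CharP (separableClosure (ZMod 2)⟮X⟯ K) 2 :=
      (algebraMap (separableClosure (ZMod 2)⟮X⟯ K) K).charP
        (algebraMap (separableClosure (ZMod 2)⟮X⟯ K) K).injective 2
    refine ⟨0, 1, ?_⟩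
    have h2 : (2 : separableClosure (ZMod 2)⟮X⟯ K) = 0 := CharTwo.two_eq_zero
    simp [q, one_add_one_eq_two, h2]
  refine hq.of_dvd (minpoly.dvd _ _ ?_)
  simpa [q] using h

section Tower

variable {K : Type*} [Field K] [Algebra (ZMod 2)[X] K] [Algebra (ZMod 2)⟮X⟯ K]
  [IsScalarTower (ZMod 2)[X] (ZMod 2)⟮X⟯ K] {c : (ZMod 2)[X]}

theorem algebraMap_mem_intermediateField (L : IntermediateField (ZMod 2)⟮X⟯ K) (f : (ZMod 2)[X]) :
    algebraMap (ZMod 2)[X] K f ∈ L := by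
  rw [IsScalarTower.algebraMap_apply (ZMod 2)[X] (ZMod 2)⟮X⟯ K]
  exact L.algebraMap_mem _

theorem IsArtinSchreierTower.eq_top (hK : IsArtinSchreierTower K c)
    {L : IntermediateField (ZMod 2)⟮X⟯ K} (hL : IsArtinSchreierClosed L) : L = ⊤ := by
  obtain ⟨ζ, α, θ, hζ, hα, hθ, htop⟩ := hK
  have hT : T K ∈ L := algebraMap_mem_intermediateField L _
  have hTi : IsIntegral (ZMod 2)[X] (T K) := isIntegral_T
  have hcL := algebraMap_mem_intermediateField L c
  have hζi := isIntegral_of_sq_add_self hζ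
  have hζL : ζ ∈ L := hL _ _ L.one_mem isIntegral_one hζ
  have hαi := isIntegral_artinSchreier (hζi.mul hTi) hα
  have hαL : α ∈ L := hL _ _ (L.mul_mem hζL hT) (hζi.mul hTi) hα
  have hθL : θ ∈ L := by
    refine hL θ ((T K ^ 2 + ζ * T K) * α + algebraMap (ZMod 2)[X] K c) ?_ ?_ (by
      rw [← hθ]; ring)
    · exact L.add_mem (L.mul_mem (L.add_mem (pow_mem hT 2) (L.mul_mem hζL hT)) hαL) hcL
    · exact (((hTi.pow 2).add (hζi.mul hTi)).mul hαi).add isIntegral_algebraMap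
  rw [eq_top_iff, ← htop, IntermediateField.adjoin_le_iff]
  rintro x (rfl | rfl | rfl) <;> assumption

theorem IsArtinSchreierTower.finiteDimensional (hK : IsArtinSchreierTower K c) :
    FunctionField (ZMod 2) K := by
  obtain ⟨ζ, α, θ, hζ, hα, hθ, htop⟩ := hK
  have hTi : IsIntegral (ZMod 2)[X] (T K) := isIntegral_T
  have hζi := isIntegral_of_sq_add_self hζ
  have hαi := isIntegral_artinSchreier (hζi.mul hTi) hα
  have hθi : IsIntegral (ZMod 2)[X] θ :=
    isIntegral_artinSchreier (c := (T K ^ 2 + ζ * T K) * α + algebraMap (ZMod 2)[X] K c)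
      ((((hTi.pow 2).add (hζi.mul hTi)).mul hαi).add isIntegral_algebraMap) (by rw [← hθ]; ring)
  have : FiniteDimensional (ZMod 2)⟮X⟯
      (IntermediateField.adjoin (ZMod 2)⟮X⟯ ({ζ, α, θ} : Set K)) := by
    refine IntermediateField.finiteDimensional_adjoin ?_
    rintro x (rfl | rfl | rfl)
    exacts [hζi.tower_top, hαi.tower_top, hθi.tower_top]
  rw [htop] at this
  exact finiteDimensional_of_top this

theorem IsArtinSchreierTower.isSeparable (hK : IsArtinSchreierTower K c) :
    Algebra.IsSeparable (ZMod 2)⟮X⟯ K :=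
  (separableClosure.eq_top_iff _ _).mp (hK.eq_top (isArtinSchreierClosed_separableClosure K))

variable {N : Type*} [Field N] [Algebra (ZMod 2)[X] N] [Algebra (ZMod 2)⟮X⟯ N]
  [IsScalarTower (ZMod 2)[X] (ZMod 2)⟮X⟯ N]

/-- The preimages of `L` under the embeddings of `K` into `N` are again closed, hence equal to `K`. -/
theorem IsArtinSchreierTower.eq_top_of_isNormalClosure (hK : IsArtinSchreierTower K c)
    (hN : IsNormalClosure (ZMod 2)⟮X⟯ K N) {L : IntermediateField (ZMod 2)⟮X⟯ N}
    (hL : IsArtinSchreierClosed L) : L = ⊤ := by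
  have := hK.finiteDimensional
  rw [eq_top_iff, ← (Algebra.IsAlgebraic.isNormalClosure_iff.mp hN).2, normalClosure_le_iff]
  intro f
  have hf : L.comap f = ⊤ := by
    refine hK.eq_top fun a c hc hcR h => hL (f a) (f c) hc ?_ ?_
    · exact hcR.map (f.restrictScalars (ZMod 2)[X])
    · rw [← map_pow, ← map_add, ← map_add, h, map_zero]
  rintro _ ⟨x, rfl⟩
  have : x ∈ L.comap f := hf ▸ trivial
  exact this

theorem IsArtinSchreierTower.isGalois_normalClosure (hK : IsArtinSchreierTower K c)
    (hN : IsNormalClosure (ZMod 2)⟮X⟯ K N) : IsGalois (ZMod 2)⟮X⟯ N := by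
  have := hN.normal
  have : Algebra.IsSeparable (ZMod 2)⟮X⟯ N := (separableClosure.eq_top_iff _ _).mp
    (hK.eq_top_of_isNormalClosure hN (isArtinSchreierClosed_separableClosure N))
  exact ⟨⟩

theorem IsArtinSchreierTower.unramified_normalClosure (hK : IsArtinSchreierTower K c)
    (hN : IsNormalClosure (ZMod 2)⟮X⟯ K N) : UnramifiedAtFinitePlaces (ZMod 2)⟮X⟯ N := by
  have := hK.finiteDimensional
  have : FiniteDimensional (ZMod 2)⟮X⟯ N := by
    have h := normalClosure.is_finiteDimensional (ZMod 2)⟮X⟯ K N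
    rw [(Algebra.IsAlgebraic.isNormalClosure_iff.mp hN).2] at h
    exact finiteDimensional_of_top h
  exact unramified_of_forall_isArtinSchreierClosed fun L hL => hK.eq_top_of_isNormalClosure hN hL

end Tower

/-! ### Points of the ring of integers with values in an algebra -/

section Step

variable {R K : Type*} [CommRing R] [CommRing K] [Algebra R K]

/-- The `S`-algebra `S'` is free with basis `1, a`, where `a² + a + c = 0` and `c ∈ S`. -/
structure IsArtinSchreierStep (S S' : Subalgebra R K) (a c : K) : Prop where
  le : S ≤ S'
  const_mem : c ∈ S
  root_mem : a ∈ S'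
  root_eq : a ^ 2 + a + c = 0
  exists_eq : ∀ x ∈ S', ∃ u ∈ S, ∃ v ∈ S, x = u + v * a
  indep : ∀ u ∈ S, ∀ v ∈ S, u + v * a = 0 → v = 0

variable {S S' : Subalgebra R K} {a c : K} {B : Type*} [CommRing B] [Algebra R B]

theorem IsArtinSchreierStep.exists_lift (h : IsArtinSchreierStep S S' a c) (φ : S →ₐ[R] B) {y : B}
    (hy : y ^ 2 + y + φ ⟨c, h.const_mem⟩ = 0) :
    ∃ ψ : S' →ₐ[R] B, ψ.comp (Subalgebra.inclusion h.le) = φ ∧ ψ ⟨a, h.root_mem⟩ = y := by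
  have hex : ∀ x : S', ∃ u v : S, (x : K) = u + v * a := fun x => by
    obtain ⟨u, hu, v, hv, e⟩ := h.exists_eq x x.2
    exact ⟨⟨u, hu⟩, ⟨v, hv⟩, e⟩
  choose u v huv using hex
  have key : ∀ (x : S') (u' v' : S), (x : K) = u' + v' * a →
      φ (u x) + φ (v x) * y = φ u' + φ v' * y := by
    intro x u' v' hx
    have h0 : ((u x - u' : S) : K) + ((v x - v' : S) : K) * a = 0 := by
      push_cast
      linear_combination hx - huv x
    have hv0 : v x - v' = 0 := Subtype.ext (h.indep _ (u x - u').2 _ (v x - v').2 h0)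
    have hu0 : u x - u' = 0 := by
      refine Subtype.ext ?_
      rw [hv0] at h0
      simpa using h0
    rw [sub_eq_zero.mp hv0, sub_eq_zero.mp hu0]
  refine ⟨AlgHom.mk ⟨⟨⟨fun x => φ (u x) + φ (v x) * y, ?_⟩, ?_⟩, ?_, ?_⟩ ?_, ?_, ?_⟩
  · exact (key 1 1 0 (by simp)).trans (by simp)
  · intro x x'
    -- `a² = -a - c` gives the coordinates of the product
    have e := key (x * x') (u x * u x' - v x * v x' * ⟨c, h.const_mem⟩)
      (u x * v x' + v x * u x' - v x * v x') (by
        push_cast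
        rw [huv x, huv x']
        linear_combination (v x : K) * v x' * h.root_eq)
    refine e.trans ?_
    simp only [map_add, map_sub, map_mul]
    linear_combination - φ (v x) * φ (v x') * hy
  · exact (key 0 0 0 (by simp)).trans (by simp)
  · intro x x'
    have e := key (x + x') (u x + u x') (v x + v x') (by
        push_cast
        rw [huv x, huv x']
        ring)
    refine e.trans ?_
    simp only [map_add]
    ring
  · intro r
    exact (key (algebraMap R S' r) (algebraMap R S r) 0 (by simp)).trans (by simp)
  · ext x
    exact (key (Subalgebra.inclusion h.le x) x 0 (by simp)).trans (by simp)
  · exact (key ⟨a, h.root_mem⟩ 0 1 (by simp)).trans (by simp)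

theorem IsArtinSchreierStep.algHom_ext (h : IsArtinSchreierStep S S' a c) {ψ ψ' : S' →ₐ[R] B}
    (h1 : ψ.comp (Subalgebra.inclusion h.le) = ψ'.comp (Subalgebra.inclusion h.le))
    (h2 : ψ ⟨a, h.root_mem⟩ = ψ' ⟨a, h.root_mem⟩) : ψ = ψ' := by
  ext x
  obtain ⟨u, hu, v, hv, e⟩ := h.exists_eq x x.2
  have hx : x = Subalgebra.inclusion h.le ⟨u, hu⟩ + Subalgebra.inclusion h.le ⟨v, hv⟩ *
    ⟨a, h.root_mem⟩ := Subtype.ext e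
  have h1' := fun z => DFunLike.congr_fun h1 z
  simp only [AlgHom.comp_apply] at h1'
  rw [hx, map_add, map_mul, map_add, map_mul, h1', h1', h2]

end Step

section IntegralElements

variable (R : Type*) {F K : Type*} [CommRing R] [Field F] [Field K] [Algebra R F] [Algebra R K]
  [Algebra F K] [IsScalarTower R F K]

/-- The ring of elements of `L` that are integral over `R`. -/
noncomputable def integralElements (L : IntermediateField F K) : Subalgebra R K :=
  integralClosure R K ⊓ L.toSubalgebra.restrictScalars R

variable {R}

theorem isArtinSchreierStep_integralElements [CharP K 2] {L : IntermediateField F K} {a c : K}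
    (hc : c ∈ L) (hcR : IsIntegral R c) (h : a ^ 2 + a + c = 0) (ha : a ∉ L) :
    IsArtinSchreierStep (integralElements R L)
      (integralElements R (L ⊔ IntermediateField.adjoin F {a})) a c where
  le := fun x hx => ⟨hx.1, (le_sup_left : L ≤ _) hx.2⟩
  const_mem := ⟨hcR, hc⟩
  root_mem := ⟨isIntegral_artinSchreier hcR h,
    (le_sup_right : _ ≤ L ⊔ _) (IntermediateField.mem_adjoin_simple_self F a)⟩
  root_eq := h
  exists_eq := fun x hx => by
    obtain ⟨u, hu, v, hv, hui, hvi, e⟩ := exists_isIntegral_eq_add_mul L hc hcR h hx.2 hx.1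
    exact ⟨u, ⟨hui, hu⟩, v, ⟨hvi, hv⟩, e⟩
  indep := fun u hu v hv e => by
    by_contra hv0
    refine ha ?_
    have : a = -u / v := by
      rw [eq_div_iff hv0]
      linear_combination e
    rw [this]
    exact L.div_mem (L.neg_mem hu.2) hv.2

theorem integralElements_bot [IsDomain R] [IsIntegrallyClosed R] [IsFractionRing R F] :
    integralElements R (⊥ : IntermediateField F K) = ⊥ := by
  refine le_antisymm ?_ bot_le
  rintro x ⟨hx, hxL⟩
  obtain ⟨y, rfl⟩ := IntermediateField.mem_bot.mp hxL
  have hy : IsIntegral R y := (isIntegral_algHom_iff (IsScalarTower.toAlgHom R F K)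
    (algebraMap F K).injective).mp hx
  obtain ⟨r, rfl⟩ := IsIntegrallyClosed.isIntegral_iff.mp hy
  rw [← IsScalarTower.algebraMap_apply]
  exact Subalgebra.algebraMap_mem _ r

end IntegralElements

section Presentation

variable {K : Type*} [Field K] [Algebra (ZMod 2)[X] K] [Algebra (ZMod 2)⟮X⟯ K]
  [IsScalarTower (ZMod 2)[X] (ZMod 2)⟮X⟯ K] {c : (ZMod 2)[X]}

theorem sq_add_self_add_one_ne_zero (g : (ZMod 2)[X]) : g ^ 2 + g + 1 ≠ 0 := by
  intro h
  have h' := congrArg (Polynomial.eval 0) h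
  simp only [Polynomial.eval_add, Polynomial.eval_pow, Polynomial.eval_one,
    Polynomial.eval_zero] at h'
  exact absurd h' ((by decide : ∀ z : ZMod 2, z ^ 2 + z + 1 ≠ 0) _)

theorem sq_add_self_add_X_ne_zero (g : (ZMod 2)[X]) : g ^ 2 + g + Polynomial.X ≠ 0 := by
  intro h
  have h' := congrArg (Polynomial.eval 1) h
  simp only [Polynomial.eval_add, Polynomial.eval_pow, Polynomial.eval_X,
    Polynomial.eval_zero] at h'
  exact absurd h' ((by decide : ∀ z : ZMod 2, z ^ 2 + z + 1 ≠ 0) _)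

/-- The ring of integers is `𝔽₂[T][ζ][α][θ]`, each step being free of rank two. The three steps are
proper because neither `z² + z = 1` nor `z² + z = T` has a solution in `𝔽₂[T]`: the latter is the
equation satisfied by the coordinate along `ζ` of a putative `α ∈ 𝔽₂(T)(ζ)`, and also by the
coordinate along `ζ α` of a putative `θ ∈ 𝔽₂(T)(ζ, α)`. -/
theorem exists_isArtinSchreierStep {ζ α θ : K} (hζ : ζ ^ 2 + ζ + 1 = 0)
    (hα : α ^ 2 + α + ζ * T K = 0)
    (hθ : θ ^ 2 + θ + ((T K ^ 2 + ζ * T K) * α + algebraMap (ZMod 2)[X] K c) = 0)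
    (htop : IntermediateField.adjoin (ZMod 2)⟮X⟯ {ζ, α, θ} = ⊤) :
    ∃ S₁ S₂ : Subalgebra (ZMod 2)[X] K, IsArtinSchreierStep ⊥ S₁ ζ 1 ∧
      IsArtinSchreierStep S₁ S₂ α (ζ * T K) ∧
      IsArtinSchreierStep S₂ (FunctionField.ringOfIntegers (ZMod 2) K) θ
        ((T K ^ 2 + ζ * T K) * α + algebraMap (ZMod 2)[X] K c) := by
  have := charP_two K
  have h2 : (2 : K) = 0 := CharTwo.two_eq_zero
  have hinj : Function.Injective (algebraMap (ZMod 2)[X] K) :=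
    FunctionField.algebraMap_injective (ZMod 2) K
  have hTi : IsIntegral (ZMod 2)[X] (T K) := isIntegral_T
  have hζi := isIntegral_of_sq_add_self hζ
  have hαi := isIntegral_artinSchreier (hζi.mul hTi) hα
  have hci : IsIntegral (ZMod 2)[X] ((T K ^ 2 + ζ * T K) * α + algebraMap (ZMod 2)[X] K c) :=
    (((hTi.pow 2).add (hζi.mul hTi)).mul hαi).add isIntegral_algebraMap
  have hθi := isIntegral_artinSchreier hci hθ
  have hTm (L : IntermediateField (ZMod 2)⟮X⟯ K) : T K ∈ L := algebraMap_mem_intermediateField L _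
  set E₁ : IntermediateField (ZMod 2)⟮X⟯ K := ⊥ ⊔ IntermediateField.adjoin _ {ζ} with hE₁
  set E₂ : IntermediateField (ZMod 2)⟮X⟯ K := E₁ ⊔ IntermediateField.adjoin _ {α} with hE₂
  have hζE₁ : ζ ∈ E₁ :=
    (le_sup_right : _ ≤ E₁) (IntermediateField.mem_adjoin_simple_self (ZMod 2)⟮X⟯ ζ)
  have hαE₂ : α ∈ E₂ :=
    (le_sup_right : _ ≤ E₂) (IntermediateField.mem_adjoin_simple_self (ZMod 2)⟮X⟯ α)
  have hbot : integralElements (ZMod 2)[X] (⊥ : IntermediateField (ZMod 2)⟮X⟯ K) = ⊥ :=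
    integralElements_bot
  have step₁ : IsArtinSchreierStep ⊥ (integralElements (ZMod 2)[X] E₁) ζ 1 := by
    rw [← hbot]
    refine isArtinSchreierStep_integralElements (one_mem _) isIntegral_one hζ fun hmem => ?_
    have hmem' : ζ ∈ integralElements (ZMod 2)[X] (⊥ : IntermediateField (ZMod 2)⟮X⟯ K) :=
      ⟨hζi, hmem⟩
    rw [hbot] at hmem'
    obtain ⟨g, rfl⟩ := Algebra.mem_bot.mp hmem'
    refine sq_add_self_add_one_ne_zero g (hinj ?_)
    simpa using hζ
  -- the coordinate along `ζ` of a solution of `z² + z + r + ζ T = 0`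
  have no_root : ∀ v ∈ integralElements (ZMod 2)[X] E₁, ∀ r : (ZMod 2)[X],
      v ^ 2 + v + algebraMap (ZMod 2)[X] K r + ζ * T K ≠ 0 := by
    intro v hv r hvr
    obtain ⟨_, hg, _, hh, rfl⟩ := step₁.exists_eq v hv
    obtain ⟨g, rfl⟩ := Algebra.mem_bot.mp hg
    obtain ⟨h, rfl⟩ := Algebra.mem_bot.mp hh
    have e := step₁.indep (algebraMap _ K (g ^ 2 + g + h ^ 2 + r))
      (Subalgebra.algebraMap_mem _ _) (algebraMap _ K (h ^ 2 + h + Polynomial.X))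
      (Subalgebra.algebraMap_mem _ _) (by
        simp only [map_add, map_pow]
        change _ + (_ + _ + T K) * ζ = 0
        set g' := algebraMap (ZMod 2)[X] K g
        set h' := algebraMap (ZMod 2)[X] K h
        linear_combination hvr - h' ^ 2 * hζ + (h' ^ 2 + h' ^ 2 * ζ - g' * h' * ζ) * h2)
    exact sq_add_self_add_X_ne_zero h (hinj (e.trans (map_zero _).symm))
  have step₂ : IsArtinSchreierStep (integralElements (ZMod 2)[X] E₁)
      (integralElements (ZMod 2)[X] E₂) α (ζ * T K) := by
    refine isArtinSchreierStep_integralElements (mul_mem hζE₁ (hTm _)) (hζi.mul hTi) hα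
      fun hmem => no_root α ⟨hαi, hmem⟩ 0 ?_
    rw [map_zero, add_zero, hα]
  refine ⟨_, _, step₁, step₂, ?_⟩
  have hE₃ : E₂ ⊔ IntermediateField.adjoin (ZMod 2)⟮X⟯ {θ} = ⊤ := by
    rw [eq_top_iff, ← htop, IntermediateField.adjoin_le_iff]
    rintro x (rfl | rfl | rfl)
    · exact (le_sup_left.trans le_sup_left : E₁ ≤ E₂ ⊔ _) hζE₁
    · exact (le_sup_left : E₂ ≤ E₂ ⊔ _) hαE₂
    · exact (le_sup_right : _ ≤ E₂ ⊔ _) (IntermediateField.mem_adjoin_simple_self _ _)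
  have hO : integralElements (ZMod 2)[X] (⊤ : IntermediateField (ZMod 2)⟮X⟯ K) =
      FunctionField.ringOfIntegers (ZMod 2) K :=
    le_antisymm (fun x hx => hx.1) fun x hx => ⟨hx, trivial⟩
  rw [← hO, ← hE₃]
  have hζE₂ : ζ ∈ E₂ := (le_sup_left : E₁ ≤ E₂) hζE₁
  refine isArtinSchreierStep_integralElements
    (add_mem (mul_mem (add_mem (pow_mem (hTm _) 2) (mul_mem hζE₂ (hTm _))) hαE₂)
      (algebraMap_mem_intermediateField _ _)) hci hθ fun hmem => ?_
  obtain ⟨u, hu, v, hv, rfl⟩ := step₂.exists_eq θ ⟨hθi, hmem⟩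
  have hTS : T K ∈ integralElements (ZMod 2)[X] E₁ := ⟨hTi, hTm _⟩
  have hζS : ζ ∈ integralElements (ZMod 2)[X] E₁ := ⟨hζi, hζE₁⟩
  have hcS : algebraMap (ZMod 2)[X] K c ∈ integralElements (ZMod 2)[X] E₁ :=
    Subalgebra.algebraMap_mem _ _
  refine no_root v hv (Polynomial.X ^ 2) ?_
  rw [map_pow]
  change v ^ 2 + v + T K ^ 2 + ζ * T K = 0
  refine step₂.indep (u ^ 2 + u + v ^ 2 * (ζ * T K) + algebraMap (ZMod 2)[X] K c)
    (add_mem (add_mem (add_mem (pow_mem hu 2) hu) (mul_mem (pow_mem hv 2) (mul_mem hζS hTS))) hcS)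
    _ (add_mem (add_mem (add_mem (pow_mem hv 2) hv) (pow_mem hTS 2)) (mul_mem hζS hTS)) ?_
  linear_combination hθ - v ^ 2 * hα + (v ^ 2 * α + v ^ 2 * (ζ * T K) - u * v * α) * h2

/-- The solutions `(z, a, h)` in `B` of the equations satisfied by `(ζ, α, θ)`, with `t` and `d` in
place of `T` and `c(T)`. -/
abbrev TowerSolutions (B : Type*) [CommRing B] (t d : B) : Type _ :=
  {q : B × B × B // q.1 ^ 2 + q.1 + 1 = 0 ∧ q.2.1 ^ 2 + q.2.1 + q.1 * t = 0 ∧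
    q.2.2 ^ 2 + q.2.2 + ((t ^ 2 + q.1 * t) * q.2.1 + d) = 0}

/-- A homomorphism from the ring of integers is determined by the images of `ζ`, `α` and `θ`, which
can be any solution of their equations. -/
theorem IsArtinSchreierTower.card_algHom (hK : IsArtinSchreierTower K c) (B : Type*) [CommRing B]
    [Algebra (ZMod 2)[X] B] :
    Nat.card (OInt K →ₐ[(ZMod 2)[X]] B) =
      Nat.card (TowerSolutions B (algebraMap (ZMod 2)[X] B Polynomial.X)
        (algebraMap (ZMod 2)[X] B c)) := by
  obtain ⟨ζ, α, θ, hζ, hα, hθ, htop⟩ := hK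
  rw [add_assoc (θ ^ 2 + θ)] at hθ
  obtain ⟨S₁, S₂, step₁, step₂, step₃⟩ := exists_isArtinSchreierStep hζ hα hθ htop
  have hinj : Function.Injective (algebraMap (ZMod 2)[X] K) :=
    FunctionField.algebraMap_injective (ZMod 2) K
  let ζ' : OInt K := ⟨ζ, step₃.le (step₂.le step₁.root_mem)⟩
  let α' : OInt K := ⟨α, step₃.le step₂.root_mem⟩
  let θ' : OInt K := ⟨θ, step₃.root_mem⟩
  have hζ' : ζ' ^ 2 + ζ' + 1 = 0 := Subtype.ext hζ
  have hα' : α' ^ 2 + α' + ζ' * algebraMap (ZMod 2)[X] _ Polynomial.X = 0 :=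
    Subtype.ext hα
  have hθ' : θ' ^ 2 + θ' + ((algebraMap (ZMod 2)[X] _ Polynomial.X ^ 2 +
    ζ' * algebraMap (ZMod 2)[X] _ Polynomial.X) * α' + algebraMap (ZMod 2)[X] _ c) = 0 := Subtype.ext hθ
  refine Nat.card_eq_of_bijective (fun ψ => ⟨(ψ ζ', ψ α', ψ θ'), ?_, ?_, ?_⟩) ⟨?_, ?_⟩
  · simpa using congrArg ψ hζ'
  · simpa using congrArg ψ hα'
  · simpa using congrArg ψ hθ'
  · intro ψ ψ' h
    simp only [Subtype.mk.injEq, Prod.mk.injEq] at h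
    refine step₃.algHom_ext (step₂.algHom_ext (step₁.algHom_ext ?_ h.1) h.2.1) h.2.2
    ext ⟨x, hx⟩
    obtain ⟨r, rfl⟩ := Algebra.mem_bot.mp hx
    exact (ψ.commutes r).trans (ψ'.commutes r).symm
  · rintro ⟨⟨z, a, h⟩, hz, ha, hh⟩
    simp only at hz ha hh
    let φ₀ : (⊥ : Subalgebra (ZMod 2)[X] K) →ₐ[(ZMod 2)[X]] B :=
      (Algebra.ofId (ZMod 2)[X] B).comp (Algebra.botEquivOfInjective hinj).toAlgHom
    obtain ⟨φ₁, hφ₁, rfl⟩ := step₁.exists_lift φ₀ (y := z) (by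
      rw [← hz]; congr 1; exact map_one φ₀)
    obtain ⟨φ₂, hφ₂, rfl⟩ := step₂.exists_lift φ₁ (y := a) (by
      rw [← ha]
      congr 1
      have : (⟨ζ * T K, step₂.const_mem⟩ : S₁) =
        ⟨ζ, step₁.root_mem⟩ * algebraMap (ZMod 2)[X] S₁ Polynomial.X := rfl
      rw [this, map_mul, AlgHom.commutes])
    have e₁ : φ₁ ⟨ζ, step₁.root_mem⟩ = φ₂ ⟨ζ, step₂.le step₁.root_mem⟩ :=
      (DFunLike.congr_fun hφ₂ ⟨ζ, step₁.root_mem⟩).symm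
    obtain ⟨φ₃, hφ₃, rfl⟩ := step₃.exists_lift φ₂ (y := h) (by
      rw [← hh]
      congr 1
      have : (⟨(T K ^ 2 + ζ * T K) * α + algebraMap (ZMod 2)[X] K c, step₃.const_mem⟩ : S₂) =
        (algebraMap (ZMod 2)[X] S₂ Polynomial.X ^ 2 + ⟨ζ, step₂.le step₁.root_mem⟩ *
          algebraMap (ZMod 2)[X] S₂ Polynomial.X) * ⟨α, step₂.root_mem⟩ +
          algebraMap (ZMod 2)[X] S₂ c := rfl
      rw [this, e₁]
      simp only [map_mul, map_add, map_pow, AlgHom.commutes])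
    refine ⟨φ₃, Subtype.ext (Prod.ext ?_ (Prod.ext ?_ rfl))⟩
    · exact (DFunLike.congr_fun hφ₃ ⟨ζ, step₂.le step₁.root_mem⟩).trans e₁.symm
    · exact DFunLike.congr_fun hφ₃ ⟨α, step₂.root_mem⟩

end Presentation

/-! ### Counting points over finite fields -/

section FiniteField

variable {B : Type*} [Field B] [CharP B 2]

/-- The additive map `x ↦ x² + x` of a field of characteristic two. -/
def artinSchreierHom (B : Type*) [Field B] [CharP B 2] : B →+ B where
  toFun x := x ^ 2 + x
  map_zero' := by simp
  map_add' x y := by rw [CharTwo.add_sq]; ring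

theorem card_ker_artinSchreierHom : Nat.card (artinSchreierHom B).ker = 2 := by
  have : ((artinSchreierHom B).ker : Set B) = {0, 1} := by
    ext x
    change x ^ 2 + x = 0 ↔ x = 0 ∨ x = 1
    rw [show x ^ 2 + x = x * (x + 1) by ring, mul_eq_zero, CharTwo.add_eq_zero]
  change Nat.card ((artinSchreierHom B).ker : Set B) = 2
  rw [this, Nat.card_coe_set_eq, Set.ncard_pair zero_ne_one]

theorem index_range_artinSchreierHom [Finite B] : (artinSchreierHom B).range.index = 2 := by
  rw [AddSubgroup.index_range, card_ker_artinSchreierHom]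

theorem exists_sq_add_self_or [Finite B] (x y : B) :
    (∃ w, w ^ 2 + w = x) ∨ (∃ w, w ^ 2 + w = y) ∨ ∃ w, w ^ 2 + w = x + y := by
  have := AddSubgroup.add_mem_iff_of_index_two (index_range_artinSchreierHom (B := B))
    (a := x) (b := y)
  change (∃ w, w ^ 2 + w = x + y) ↔ ((∃ w, w ^ 2 + w = x) ↔ ∃ w, w ^ 2 + w = y) at this
  tauto

/-- As `{w² + w}` has index two in `B`, one of `t³`, `t` and `t³ + t` has the form `w² + w`; each
case gives an explicit injection. -/
theorem card_towerSolutions_le [Finite B] (t d : B) :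
    Nat.card (TowerSolutions B t d) ≤ Nat.card (TowerSolutions B t (d + t ^ 3)) := by
  have h2 : (2 : B) = 0 := CharTwo.two_eq_zero
  obtain ⟨w, hw⟩ | ⟨u, rfl⟩ | ⟨w, hw⟩ := exists_sq_add_self_or (t ^ 3) t
  · refine Nat.card_le_card_of_injective (fun q => ⟨(q.1.1, q.1.2.1, q.1.2.2 + w), ?_⟩) ?_
    · obtain ⟨⟨z, a, h⟩, hz, ha, hh⟩ := q
      refine ⟨hz, ha, ?_⟩
      simp only at *
      grind
    · intro q q' e
      simpa [Prod.ext_iff, Subtype.ext_iff] using e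
  · refine Nat.card_le_card_of_injective (fun q => ⟨(q.1.1 + 1, q.1.2.1 + u, q.1.2.2 +
      (u ^ 3 + u ^ 2 + q.1.2.1 * u ^ 2 + q.1.2.1 * (u ^ 2 + u) + (q.1.1 + 1) * (u ^ 2 + u) +
        q.1.2.1 + u)), ?_⟩) ?_
    · obtain ⟨⟨z, a, h⟩, hz, ha, hh⟩ := q
      simp only at *
      refine ⟨?_, ?_, ?_⟩ <;> grind
    · intro q q' e
      simp only [Prod.ext_iff, Subtype.ext_iff, add_left_inj] at e ⊢
      obtain ⟨e1, e2, e3⟩ := e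
      rw [e1, e2, add_left_inj] at e3
      exact ⟨e1, e2, e3⟩
  · refine Nat.card_le_card_of_injective (fun q => ⟨(q.1.1, q.1.2.1 + 1, q.1.2.2 +
      (t + q.1.2.1 + w)), ?_⟩) ?_
    · obtain ⟨⟨z, a, h⟩, hz, ha, hh⟩ := q
      refine ⟨hz, ?_, ?_⟩
      · simp only at *
        grind
      · simp only at *
        grind
    · intro q q' e
      simp only [Prod.ext_iff, Subtype.ext_iff, add_left_inj] at e ⊢
      obtain ⟨e1, e2, e3⟩ := e
      rw [e2, add_left_inj] at e3
      exact ⟨e1, e2, e3⟩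

theorem card_towerSolutions_add_cube [Finite B] (t d : B) :
    Nat.card (TowerSolutions B t (d + t ^ 3)) = Nat.card (TowerSolutions B t d) := by
  refine le_antisymm ?_ (card_towerSolutions_le t d)
  have h := card_towerSolutions_le t (d + t ^ 3)
  rwa [add_assoc, CharTwo.add_self_eq_zero, add_zero] at h

end FiniteField

/-! ### Splitting types and points over finite fields -/

section Divisors

theorem sum_filter_dvd (s : Multiset ℕ) {n : ℕ} (hn : n ≠ 0) :
    (s.filter (· ∣ n)).sum = ∑ d ∈ n.divisors, s.count d * d := by
  rw [Finset.sum_multiset_count_of_subset _ n.divisors]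
  · refine Finset.sum_congr rfl fun d hd => ?_
    rw [Multiset.count_filter_of_pos (p := (· ∣ n)) (Nat.dvd_of_mem_divisors hd), smul_eq_mul]
  · intro d hd
    rw [Multiset.mem_toFinset, Multiset.mem_filter] at hd
    exact Nat.mem_divisors.mpr ⟨hd.2, hn⟩

theorem multiset_eq_of_sum_filter_dvd {s s' : Multiset ℕ} (hs : 0 ∉ s) (hs' : 0 ∉ s')
    (h : ∀ n ≠ 0, (s.filter (· ∣ n)).sum = (s'.filter (· ∣ n)).sum) : s = s' := by
  ext n
  induction n using Nat.strong_induction_on with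
  | _ n ih =>
    rcases eq_or_ne n 0 with rfl | hn
    · rw [Multiset.count_eq_zero_of_notMem hs, Multiset.count_eq_zero_of_notMem hs']
    have e := h n hn
    have e' : ∑ d ∈ n.properDivisors, s.count d * d = ∑ d ∈ n.properDivisors, s'.count d * d :=
      Finset.sum_congr rfl fun d hd => by rw [ih d (Nat.mem_properDivisors.mp hd).2]
    rw [sum_filter_dvd s hn, sum_filter_dvd s' hn, ← Nat.cons_self_properDivisors hn,
      Finset.sum_cons, Finset.sum_cons, e'] at e
    exact Nat.eq_of_mul_eq_mul_right (Nat.pos_of_ne_zero hn) (Nat.add_right_cancel e)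

end Divisors

section ResidueFields

variable {R O : Type*} [CommRing R] [CommRing O] [Algebra R O] {p : Ideal R} {B : Type*} [Field B]
  [Algebra R B] [Algebra (R ⧸ p) B] [IsScalarTower R (R ⧸ p) B]

/-- The algebra homomorphisms `O → B` with kernel `P` are the embeddings of the residue field of `P`
into `B`. -/
def algHomEquivOfKer (P : Ideal O) [P.LiesOver p] [P.IsMaximal] :
    {ψ : O →ₐ[R] B // RingHom.ker ψ = P} ≃ (O ⧸ P →ₐ[R ⧸ p] B) where
  toFun ψ :=
    { Ideal.Quotient.liftₐ P ψ.1 fun a ha => by rwa [← ψ.2] at ha with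
      commutes' := by
        intro r
        obtain ⟨r, rfl⟩ := Ideal.Quotient.mk_surjective r
        change ψ.1 (algebraMap R O r) = _
        rw [AlgHom.commutes, IsScalarTower.algebraMap_apply R (R ⧸ p) B]
        rfl }
  invFun φ :=
    ⟨(φ.restrictScalars R).comp (Ideal.Quotient.mkₐ R P), by
      have := Ideal.Quotient.nontrivial_iff.mpr (Ideal.IsPrime.ne_top' (I := P))
      let _ := Ideal.Quotient.field P
      ext x
      rw [RingHom.mem_ker]
      change φ (Ideal.Quotient.mk P x) = 0 ↔ _
      rw [map_eq_zero_iff φ φ.toRingHom.injective, Ideal.Quotient.eq_zero_iff_mem]⟩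
  left_inv ψ := by
    ext x
    rfl
  right_inv φ := by
    ext x
    obtain ⟨x, rfl⟩ := Ideal.Quotient.mk_surjective x
    rfl

variable [IsDomain R] [IsDedekindDomain O] [Module.Finite R O] [Module.IsTorsionFree R O]

/-- Sorting the homomorphisms by their kernels: the residue field of `P` has `f` embeddings into `B` if
its degree `f` divides that of `B`, and none otherwise. -/
theorem card_algHom_eq_sum [p.IsMaximal] (hp : p ≠ ⊥) [Finite B] :
    Nat.card (O →ₐ[R] B) = (((IsDedekindDomain.primesOverFinset p O).val.map
      fun P => P.inertiaDeg R).filter (· ∣ Module.finrank (R ⧸ p) B)).sum := by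
  classical
  let _ := Ideal.Quotient.field p
  have hmem (P : Ideal O) : P ∈ IsDedekindDomain.primesOverFinset p O ↔ P ∈ p.primesOver O :=
    IsDedekindDomain.mem_primesOverFinset_iff hp O
  have hmax (P : Ideal O) (hP : P ∈ p.primesOver O) : P.IsMaximal := by
    have := hP.1
    have := hP.2
    exact Ideal.IsMaximal.of_liesOver_isMaximal P p
  have hker (ψ : O →ₐ[R] B) : RingHom.ker ψ ∈ IsDedekindDomain.primesOverFinset p O := by
    rw [hmem]
    refine ⟨RingHom.ker_isPrime _, ⟨?_⟩⟩
    ext r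
    rw [Ideal.under_def, Ideal.mem_comap, RingHom.mem_ker, AlgHom.commutes,
      IsScalarTower.algebraMap_apply R (R ⧸ p) B, map_eq_zero_iff _ (algebraMap (R ⧸ p) B).injective,
      Ideal.Quotient.algebraMap_eq, Ideal.Quotient.eq_zero_iff_mem]
  have hfib (P : IsDedekindDomain.primesOverFinset p O) :
      Finite {ψ : O →ₐ[R] B // RingHom.ker ψ = P} ∧
      Nat.card {ψ : O →ₐ[R] B // RingHom.ker ψ = P} =
        if P.1.inertiaDeg R ∣ Module.finrank (R ⧸ p) B then P.1.inertiaDeg R else 0 := by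
    have hP := (hmem _).mp P.2
    have := hP.2
    have := hmax _ hP
    let _ := Ideal.Quotient.field P.1
    have : Finite (R ⧸ p) := Finite.of_injective _ (algebraMap (R ⧸ p) B).injective
    have : Module.Finite (R ⧸ p) (O ⧸ P.1) := Module.Finite.of_restrictScalars_finite R _ _
    have : Finite (O ⧸ P.1) := Module.finite_of_finite (R ⧸ p)
    have hfin : Finite (O ⧸ P.1 →ₐ[R ⧸ p] B) :=
      Finite.of_injective (fun f => (f : O ⧸ P.1 → B)) DFunLike.coe_injective
    refine ⟨Finite.of_equiv _ (algHomEquivOfKer (p := p) P.1).symm, ?_⟩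
    rw [Nat.card_congr (algHomEquivOfKer (p := p) P.1), Ideal.inertiaDeg_eq_of_isMaximal p P.1]
    split_ifs with h
    · exact FiniteField.natCard_algHom_of_finrank_dvd h
    · have : IsEmpty (O ⧸ P.1 →ₐ[R ⧸ p] B) := by
        rw [← not_nonempty_iff, FiniteField.nonempty_algHom_iff_finrank_dvd]
        exact h
      exact Nat.card_of_isEmpty
  have := fun P => (hfib P).1
  let e : (O →ₐ[R] B) ≃ Σ P : IsDedekindDomain.primesOverFinset p O,
      {ψ : O →ₐ[R] B // RingHom.ker ψ = P} :=
    { toFun := fun ψ => ⟨⟨RingHom.ker ψ, hker ψ⟩, ψ, rfl⟩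
      invFun := fun x => x.2.1
      left_inv := fun _ => rfl
      right_inv := by
        rintro ⟨P, ψ, hψ⟩
        exact Sigma.subtype_ext (Subtype.ext hψ) rfl }
  rw [Nat.card_congr e, Nat.card_sigma, Finset.sum_congr rfl fun P _ => (hfib P).2,
    Finset.sum_coe_sort (IsDedekindDomain.primesOverFinset p O)
      (fun P => if P.inertiaDeg R ∣ Module.finrank (R ⧸ p) B then P.inertiaDeg R else 0),
    ← Finset.sum_filter, Multiset.filter_map]
  rfl

end ResidueFields

section SplittingType

theorem finite_quotient {𝔭 : Ideal (ZMod 2)[X]} (h : 𝔭 ≠ ⊥) : Finite ((ZMod 2)[X] ⧸ 𝔭) := by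
  obtain ⟨f, rfl⟩ := (IsPrincipalIdealRing.principal 𝔭).principal
  have hf : f ≠ 0 := by
    rintro rfl
    simp at h
  have := (AdjoinRoot.powerBasis hf).finite
  exact Module.finite_of_finite (ZMod 2) (M := AdjoinRoot f)

variable {K : Type*} [Field K] [Algebra (ZMod 2)[X] K] [Algebra (ZMod 2)⟮X⟯ K]
  [IsScalarTower (ZMod 2)[X] (ZMod 2)⟮X⟯ K] [FunctionField (ZMod 2) K]
  [Algebra.IsSeparable (ZMod 2)⟮X⟯ K]
  {K' : Type*} [Field K'] [Algebra (ZMod 2)[X] K'] [Algebra (ZMod 2)⟮X⟯ K']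
  [IsScalarTower (ZMod 2)[X] (ZMod 2)⟮X⟯ K'] [FunctionField (ZMod 2) K']
  [Algebra.IsSeparable (ZMod 2)⟮X⟯ K']

instance : Module.IsTorsionFree (ZMod 2)[X] (OInt K) :=
  Module.isTorsionFree_iff_algebraMap_injective.mpr
    (FunctionField.ringOfIntegers.algebraMap_injective (ZMod 2) K)

instance : Module.Finite (ZMod 2)[X] (OInt K) := Module.IsNoetherian.finite _ _

variable (K) in
/-- The inertia degrees of the primes of `𝓞_K` above `𝔭`, with multiplicity: the splitting type
before sorting. -/
noncomputable def inertiaDegs (𝔭 : Ideal (ZMod 2)[X]) : Multiset ℕ :=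
  (IsDedekindDomain.primesOverFinset 𝔭 (OInt K)).val.map fun P => P.inertiaDeg (ZMod 2)[X]

theorem zero_notMem_inertiaDegs {𝔭 : Ideal (ZMod 2)[X]} [𝔭.IsPrime] (h : 𝔭 ≠ ⊥) :
    0 ∉ inertiaDegs K 𝔭 := by
  have := IsPrime.to_maximal_ideal h
  intro h0
  obtain ⟨P, hP, hP0⟩ := Multiset.mem_map.mp h0
  have hP' := (IsDedekindDomain.mem_primesOverFinset_iff h _).mp hP
  have := hP'.1
  exact (P.inertiaDeg_pos (ZMod 2)[X]).ne' hP0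

/-- The splitting type of a prime is determined by the numbers of points of the ring of integers
over the finite extensions of its residue field. -/
theorem inertiaDegs_eq_of_card_algHom {𝔭 : Ideal (ZMod 2)[X]} (hp : 𝔭.IsPrime) (h : 𝔭 ≠ ⊥)
    (hcard : ∀ (B : Type) [Field B] [Finite B] [Algebra (ZMod 2)[X] B],
      Nat.card (OInt K →ₐ[(ZMod 2)[X]] B) = Nat.card (OInt K' →ₐ[(ZMod 2)[X]] B)) :
    inertiaDegs K 𝔭 = inertiaDegs K' 𝔭 := by
  have := IsPrime.to_maximal_ideal h
  let _ := Ideal.Quotient.field 𝔭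
  have := finite_quotient h
  have := charP_two ((ZMod 2)[X] ⧸ 𝔭)
  refine multiset_eq_of_sum_filter_dvd (zero_notMem_inertiaDegs h) (zero_notMem_inertiaDegs h)
    fun n hn => ?_
  have : NeZero n := ⟨hn⟩
  let B := FiniteField.Extension ((ZMod 2)[X] ⧸ 𝔭) 2 n
  let _ : Algebra (ZMod 2)[X] B := Algebra.compHom B (algebraMap (ZMod 2)[X] ((ZMod 2)[X] ⧸ 𝔭))
  have : IsScalarTower (ZMod 2)[X] ((ZMod 2)[X] ⧸ 𝔭) B := .of_algebraMap_eq fun _ => rfl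
  have hB : Module.finrank ((ZMod 2)[X] ⧸ 𝔭) B = n := FiniteField.finrank_extension _ 2 n
  have e := card_algHom_eq_sum (O := OInt K) h (B := B)
  have e' := card_algHom_eq_sum (O := OInt K') h (B := B)
  rw [hcard, e'] at e
  rw [hB] at e
  exact e.symm

end SplittingType

/-! ### Goss exponentiation of one-units -/

section OneUnit

open Filter Topology

theorem v_algebraMap (r : (ZMod 2)⟮X⟯) : (Valued.v (algebraMap (ZMod 2)⟮X⟯ FInfty r) : ℤᵐ⁰) =
    @RatFunc.inftyValuation (ZMod 2) _ (Classical.decEq _) r := by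
  let _ := Classical.decEq (ZMod 2)⟮X⟯
  let _ := RatFunc.inftyValued (ZMod 2)
  exact Valued.extensionValuation_apply_coe (K := (ZMod 2)⟮X⟯) r

theorem norm_algebraMap_FInfty (z : FInfty) : ‖algebraMap FInfty CInfty z‖ = ‖z‖ :=
  norm_algebraMap' CInfty z

theorem norm_oneUnit_sub_one_lt {f : (ZMod 2)[X]} (hf : f.Monic) : ‖oneUnit f - 1‖ < 1 := by
  rw [oneUnit, ← map_one (algebraMap FInfty CInfty), ← map_sub, norm_algebraMap_FInfty,
    Valued.toNormedField.norm_lt_one_iff, ← map_one (algebraMap (ZMod 2)⟮X⟯ FInfty), ← map_sub,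
    v_algebraMap]
  let _ := Classical.decEq (ZMod 2)⟮X⟯
  have hX : (RatFunc.X : (ZMod 2)⟮X⟯) ^ f.natDegree ≠ 0 := pow_ne_zero _ RatFunc.X_ne_zero
  have e : algebraMap (ZMod 2)[X] (ZMod 2)⟮X⟯ f / RatFunc.X ^ f.natDegree - 1 =
      algebraMap (ZMod 2)[X] (ZMod 2)⟮X⟯ (f - Polynomial.X ^ f.natDegree) /
        RatFunc.X ^ f.natDegree := by
    rw [map_sub, map_pow, RatFunc.algebraMap_X, sub_div, div_self hX]
  rw [e, map_div₀, map_pow, RatFunc.inftyValuation.X]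
  rcases eq_or_ne (f - Polynomial.X ^ f.natDegree) 0 with h0 | h0
  · rw [h0]
    simp
  rw [RatFunc.inftyValuation_apply, RatFunc.inftyValuation.polynomial (ZMod 2) h0,
    ← WithZero.exp_nsmul, ← WithZero.exp_sub, ← WithZero.exp_zero, WithZero.exp_lt_exp]
  have hdeg : (f - Polynomial.X ^ f.natDegree).natDegree < f.natDegree := by
    refine Polynomial.natDegree_lt_natDegree h0 (Polynomial.degree_sub_lt_left ?_ hf.ne_zero ?_)
    · rw [Polynomial.degree_X_pow, Polynomial.degree_eq_natDegree hf.ne_zero]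
    · rw [hf.leadingCoeff, Polynomial.leadingCoeff_X_pow]
  simp only [nsmul_eq_mul, mul_one]
  omega

instance : CharP CInfty 2 := by
  have := charP_two (ZMod 2)⟮X⟯
  have := charP_of_injective_algebraMap (algebraMap (ZMod 2)⟮X⟯ FInfty).injective 2
  exact charP_of_injective_algebraMap (algebraMap FInfty CInfty).injective 2

theorem norm_eq_one_of_norm_sub_one_lt {u : CInfty} (hu : ‖u - 1‖ < 1) : ‖u‖ = 1 := by
  have h := IsUltrametricDist.norm_eq_of_add_norm_lt_max (x := u) (y := -1) (by
    rw [← sub_eq_add_neg, norm_neg, norm_one]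
    exact hu.trans_le (le_max_right _ _))
  rwa [norm_neg, norm_one] at h

theorem norm_pow_sub_one_le {w : CInfty} (hw : ‖w‖ = 1) (k : ℕ) : ‖w ^ k - 1‖ ≤ ‖w - 1‖ := by
  induction k with
  | zero => simp
  | succ k ih =>
    have e : w ^ (k + 1) - 1 = w ^ k * (w - 1) + (w ^ k - 1) := by ring
    rw [e]
    refine (IsUltrametricDist.norm_add_le_max _ _).trans (max_le ?_ ih)
    rw [norm_mul, norm_pow, hw, one_pow, one_mul]

/-- Congruent exponents give close powers, as `u ^ 2 ^ m - 1 = (u - 1) ^ 2 ^ m`. -/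
theorem norm_pow_appr_sub_le {u : CInfty} (hu : ‖u - 1‖ < 1) (y : ℤ_[2]) {m n : ℕ} (h : m ≤ n) :
    ‖u ^ y.appr n - u ^ y.appr m‖ ≤ ‖u - 1‖ ^ 2 ^ m := by
  have hu1 := norm_eq_one_of_norm_sub_one_lt hu
  obtain ⟨k, hk⟩ := PadicInt.dvd_appr_sub_appr y m n h
  have hk' : y.appr n = y.appr m + 2 ^ m * k := by
    have := PadicInt.appr_mono y h
    omega
  have e : u ^ y.appr n - u ^ y.appr m = u ^ y.appr m * ((u ^ 2 ^ m) ^ k - 1) := by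
    rw [hk', pow_add, pow_mul]
    ring
  rw [e, norm_mul, norm_pow, hu1, one_pow, one_mul, ← norm_pow]
  have e' : (u - 1) ^ 2 ^ m = u ^ 2 ^ m - 1 := by
    rw [sub_pow_char_pow, one_pow]
  rw [e']
  exact norm_pow_sub_one_le (by rw [norm_pow, hu1, one_pow]) k

theorem norm_oneUnitPow {f : (ZMod 2)[X]} (hf : f.Monic) (y : ℤ_[2]) : ‖oneUnitPow f y‖ = 1 := by
  have hu := norm_oneUnit_sub_one_lt hf
  have hu1 := norm_eq_one_of_norm_sub_one_lt hu
  have hc : CauchySeq fun n : ℕ => oneUnit f ^ y.appr n := by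
    refine cauchySeq_of_le_tendsto_0' (fun n => ‖oneUnit f - 1‖ ^ 2 ^ n) (fun m n h => ?_) ?_
    · rw [dist_comm, dist_eq_norm]
      exact norm_pow_appr_sub_le hu y h
    · exact (tendsto_pow_atTop_nhds_zero_of_lt_one (norm_nonneg _) hu).comp
        (tendsto_pow_atTop_atTop_of_one_lt one_lt_two)
  have hlim := hc.tendsto_limUnder
  have h1 : (fun n : ℕ => ‖oneUnit f ^ y.appr n‖) = fun _ => 1 := by
    funext n
    rw [norm_pow, hu1, one_pow]
  have h2 := hlim.norm
  rw [h1] at h2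
  exact tendsto_nhds_unique h2 tendsto_const_nhds

theorem norm_gossPow_neg {f : (ZMod 2)[X]} (hf : f.Monic) (s : SInfty) :
    ‖gossPow f (-s)‖ = (‖s.x‖⁻¹) ^ f.natDegree := by
  have hx : (-s).x = s.x⁻¹ := by
    change ((Additive.toMul (-s.1) : CInftyˣ) : CInfty) = _
    rw [toMul_neg, Units.val_inv_eq_inv_val]
    rfl
  rw [gossPow, norm_mul, norm_oneUnitPow hf, mul_one, norm_pow, hx, norm_inv]

end OneUnit

/-! ### Convergence in the weak topology of the Witt vectors -/

section Witt

open Filter Topology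

theorem mem_CInftyInt {z : CInfty} : z ∈ CInftyInt ↔ ‖z‖ ≤ 1 := by
  change NormedField.valuation z ≤ 1 ↔ _
  rw [NormedField.valuation_apply, ← NNReal.coe_le_coe, coe_nnnorm, NNReal.coe_one]

/-- The ideal `{z : ‖z‖ ≤ ε}` of the valuation ring. -/
def normIdeal (ε : ℝ) (hε : 0 ≤ ε) : Ideal CInftyInt where
  carrier := {z | ‖(z : CInfty)‖ ≤ ε}
  zero_mem' := by simpa using hε
  add_mem' := fun {a b} ha hb =>
    (IsUltrametricDist.norm_add_le_max (a : CInfty) b).trans (max_le ha hb)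
  smul_mem' := fun c z hz => by
    change ‖(c : CInfty) * z‖ ≤ ε
    rw [norm_mul]
    exact (mul_le_of_le_one_left (norm_nonneg _) (mem_CInftyInt.mp c.2)).trans hz

theorem map_mk_eq_zero_iff (J : Ideal CInftyInt) (x : WittVector 2 CInftyInt) :
    WittVector.map (Ideal.Quotient.mk J) x = 0 ↔ ∀ n, x.coeff n ∈ J := by
  rw [WittVector.ext_iff]
  simp only [WittVector.map_coeff, WittVector.zero_coeff, Ideal.Quotient.eq_zero_iff_mem]

/-- Reduction of the components modulo an ideal `J` is a ring homomorphism on Witt vectors. -/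
theorem coeff_sub_mem_iff (J : Ideal CInftyInt) (x y : WittVector 2 CInftyInt) :
    (∀ n, (x - y).coeff n ∈ J) ↔ ∀ n, x.coeff n - y.coeff n ∈ J := by
  rw [← map_mk_eq_zero_iff, map_sub, sub_eq_zero, WittVector.ext_iff]
  simp only [WittVector.map_coeff, Ideal.Quotient.mk_eq_mk_iff_sub_mem]

theorem coeff_sum_mem {ι : Type*} (J : Ideal CInftyInt) (f : ι → WittVector 2 CInftyInt)
    (F : Finset ι) (h : ∀ i ∈ F, ∀ n, (f i).coeff n ∈ J) (n : ℕ) : (∑ i ∈ F, f i).coeff n ∈ J := by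
  refine (map_mk_eq_zero_iff J _).mp ?_ n
  rw [map_sum]
  exact Finset.sum_eq_zero fun i hi => (map_mk_eq_zero_iff J _).mpr (h i hi)

theorem exists_normIdeal_le {I : Ideal CInftyInt} (hI : IsOpen (I : Set CInftyInt)) :
    ∃ ε, ∃ hε : 0 < ε, normIdeal ε hε.le ≤ I := by
  obtain ⟨ε, hε, h⟩ := Metric.isOpen_iff.mp hI 0 I.zero_mem
  refine ⟨ε / 2, half_pos hε, fun z hz => h ?_⟩
  rw [mem_ball_zero_iff]
  exact (show ‖(z : CInfty)‖ ≤ ε / 2 from hz).trans_lt (half_lt_self hε)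

/-- The Witt vectors of the valuation ring are complete: the limit of a Cauchy net of partial sums
is computed componentwise, since the difference of two Witt vectors lies in `W(J)` if and only if
their components agree modulo `J`. -/
theorem summable_teichmuller {ι : Type*} {t : ι → CInfty} (ht : ∀ i, ‖t i‖ ≤ 1)
    (h0 : Tendsto (fun i => ‖t i‖) cofinite (𝓝 0)) :
    Summable fun i => (WittVector.teichmuller 2 (t i) : W) := by
  classical
  let f : ι → WittVector 2 CInftyInt := fun i =>
    WittVector.teichmuller 2 ⟨t i, mem_CInftyInt.mpr (ht i)⟩
  let S : Finset ι → WittVector 2 CInftyInt := fun F => ∑ i ∈ F, f i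
  have hS : ∀ ε, ∀ hε : 0 < ε, ∃ F₀, ∀ F, F₀ ⊆ F → ∀ n,
      (S F).coeff n - (S F₀).coeff n ∈ normIdeal ε hε.le := by
    intro ε hε
    have hfin : {i | ¬ ‖t i‖ < ε}.Finite := (h0.eventually_lt_const hε)
    refine ⟨hfin.toFinset, fun F hF => (coeff_sub_mem_iff _ _ _).mp ?_⟩
    have e : S F - S hfin.toFinset = ∑ i ∈ F \ hfin.toFinset, f i := by
      rw [sub_eq_iff_eq_add]
      exact (Finset.sum_sdiff hF).symm
    rw [e]
    refine coeff_sum_mem _ _ _ fun i hi n => ?_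
    have hi' : ‖t i‖ < ε := by simpa using (Finset.mem_sdiff.mp hi).2
    rcases Nat.eq_zero_or_pos n with rfl | hn
    · rw [WittVector.teichmuller_coeff_zero]
      exact hi'.le
    · rw [WittVector.teichmuller_coeff_pos _ _ _ hn]
      exact zero_mem _
  have hcauchy : ∀ n, CauchySeq fun F => ((S F).coeff n : CInfty) := by
    intro n
    rw [Metric.cauchySeq_iff']
    intro ε hε
    obtain ⟨F₀, hF₀⟩ := hS (ε / 2) (half_pos hε)
    refine ⟨F₀, fun F hF => ?_⟩
    rw [dist_eq_norm]
    exact (show ‖((S F).coeff n : CInfty) - (S F₀).coeff n‖ ≤ ε / 2 from hF₀ F hF n).trans_lt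
      (half_lt_self hε)
  choose L hL using fun n => cauchySeq_tendsto_of_complete (hcauchy n)
  have hL1 : ∀ n, L n ∈ CInftyInt := fun n => mem_CInftyInt.mpr
    (le_of_tendsto (hL n).norm (Eventually.of_forall fun F => mem_CInftyInt.mp ((S F).coeff n).2))
  let Λ : WittVector 2 CInftyInt := WittVector.mk 2 fun n => ⟨L n, hL1 n⟩
  let φ : WittVector 2 CInftyInt →+* W := WittVector.map CInftyInt.subtype
  refine ⟨φ Λ, tendsto_nhds.mpr fun U hU hΛ => ?_⟩
  obtain ⟨I, m, hI, hIU⟩ := hU _ hΛ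
  obtain ⟨ε, hε, hεI⟩ := exists_normIdeal_le hI
  obtain ⟨F₀, hF₀⟩ := hS ε hε
  have hlim : ∀ n, Λ.coeff n - (S F₀).coeff n ∈ normIdeal ε hε.le := by
    intro n
    refine le_of_tendsto ((hL n).sub_const ((S F₀).coeff n : CInfty)).norm ?_
    filter_upwards [eventually_ge_atTop F₀] with F hF
    exact hF₀ F hF n
  filter_upwards [eventually_ge_atTop F₀] with F hF
  have hsum : ∑ i ∈ F, (WittVector.teichmuller 2 (t i) : W) = φ Λ + φ (S F - Λ) := by
    rw [← map_add, add_sub_cancel, map_sum]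
    exact Finset.sum_congr rfl fun i _ =>
      (WittVector.map_teichmuller 2 CInftyInt.subtype ⟨t i, mem_CInftyInt.mpr (ht i)⟩).symm
  change ∑ i ∈ F, (WittVector.teichmuller 2 (t i) : W) ∈ U
  rw [hsum]
  have hmem := (coeff_sub_mem_iff (normIdeal ε hε.le) (S F) Λ).mpr fun n => by
    have := sub_mem (hF₀ F hF n) (hlim n)
    rwa [sub_sub_sub_cancel_right] at this
  exact hIU _ fun i _ => ⟨(S F - Λ).coeff i, hεI (hmem i), rfl⟩

end Witt

/-! ### Norms of ideals and the lifted zeta function -/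

section Ideals

open IsDedekindDomain (HeightOneSpectrum)
open UniqueFactorizationMonoid Filter Topology

variable (K : Type*) [Field K] [Algebra (ZMod 2)[X] K] [Algebra (ZMod 2)⟮X⟯ K]
  [IsScalarTower (ZMod 2)[X] (ZMod 2)⟮X⟯ K] [FunctionField (ZMod 2) K]
  [Algebra.IsSeparable (ZMod 2)⟮X⟯ K]
  (K' : Type*) [Field K'] [Algebra (ZMod 2)[X] K'] [Algebra (ZMod 2)⟮X⟯ K']
  [IsScalarTower (ZMod 2)[X] (ZMod 2)⟮X⟯ K'] [FunctionField (ZMod 2) K']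
  [Algebra.IsSeparable (ZMod 2)⟮X⟯ K']

/-- The product of a multiset of nonzero primes, as a nonzero ideal. -/
noncomputable def primesProd (m : Multiset (HeightOneSpectrum (OInt K))) :
    {I : Ideal (OInt K) // I ≠ ⊥} :=
  ⟨(m.map HeightOneSpectrum.asIdeal).prod, Multiset.prod_ne_zero fun h => by
    obtain ⟨v, _, hv⟩ := Multiset.mem_map.mp h
    exact v.ne_bot hv⟩

variable {K}

theorem normalizedFactors_primesProd (m : Multiset (HeightOneSpectrum (OInt K))) :
    normalizedFactors (primesProd K m).1 = m.map HeightOneSpectrum.asIdeal :=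
  normalizedFactors_prod_of_prime fun P hP => by
    obtain ⟨v, _, rfl⟩ := Multiset.mem_map.mp hP
    exact v.prime

theorem primesProd_bijective : Function.Bijective (primesProd K) := by
  constructor
  · intro m m' h
    refine Multiset.map_injective (fun v v' => HeightOneSpectrum.ext) ?_
    rw [← normalizedFactors_primesProd, h, normalizedFactors_primesProd]
  · rintro ⟨I, hI⟩
    refine ⟨(normalizedFactors I).pmap (fun P hP => ⟨P, Ideal.isPrime_of_prime hP, hP.ne_zero⟩)
      fun P hP => prime_of_normalized_factor P hP, Subtype.ext ?_⟩
    change (Multiset.map _ _).prod = I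
    rw [Multiset.map_pmap, Multiset.pmap_eq_map, Multiset.map_id']
    exact associated_iff_eq.mp (prod_normalizedFactors hI)

theorem idealNorm_primesProd (m : Multiset (HeightOneSpectrum (OInt K))) :
    idealNorm (primesProd K m).1 = (m.map fun v => primeNorm v.asIdeal).prod := by
  rw [idealNorm, normalizedFactors_primesProd, Multiset.map_map]
  rfl

theorem under_ne_bot (v : HeightOneSpectrum (OInt K)) : v.asIdeal.under (ZMod 2)[X] ≠ ⊥ :=
  Ideal.IsIntegral.comap_ne_bot (ZMod 2)[X] v.ne_bot

theorem monic_primeNorm (v : HeightOneSpectrum (OInt K)) : (primeNorm v.asIdeal).Monic := by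
  refine Polynomial.Monic.pow (Polynomial.monic_normalize fun h => under_ne_bot v ?_) _
  rwa [← Submodule.IsPrincipal.eq_bot_iff_generator_eq_zero] at h

theorem algebraMap_primeNorm_mem (v : HeightOneSpectrum (OInt K)) :
    algebraMap (ZMod 2)[X] (OInt K) (primeNorm v.asIdeal) ∈ v.asIdeal := by
  have h : normalize (Submodule.IsPrincipal.generator (v.asIdeal.under (ZMod 2)[X])) ∈
      v.asIdeal.under (ZMod 2)[X] :=
    Ideal.mem_of_dvd _ (normalize_associated _).symm.dvd
      (Submodule.IsPrincipal.generator_mem _)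
  rw [primeNorm, map_pow]
  exact Ideal.pow_mem_of_mem v.asIdeal h _ (v.asIdeal.inertiaDeg_pos (ZMod 2)[X])

theorem monic_idealNorm (I : {I : Ideal (OInt K) // I ≠ ⊥}) : (idealNorm I.1).Monic := by
  obtain ⟨m, rfl⟩ := primesProd_bijective.2 I
  rw [idealNorm_primesProd]
  exact Polynomial.monic_multiset_prod_of_monic _ _ fun v _ => monic_primeNorm v

theorem algebraMap_idealNorm_mem (I : {I : Ideal (OInt K) // I ≠ ⊥}) :
    algebraMap (ZMod 2)[X] (OInt K) (idealNorm I.1) ∈ I.1 := by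
  obtain ⟨m, rfl⟩ := primesProd_bijective.2 I
  rw [idealNorm_primesProd]
  change _ ∈ (m.map HeightOneSpectrum.asIdeal).prod
  induction m using Multiset.induction_on with
  | empty => simp
  | cons v m ih =>
    rw [Multiset.map_cons, Multiset.prod_cons, Multiset.map_cons, Multiset.prod_cons, map_mul]
    exact Ideal.mul_mem_mul (algebraMap_primeNorm_mem v) ih

theorem finite_setOf_natDegree_le (D : ℕ) : {f : (ZMod 2)[X] | f.natDegree ≤ D}.Finite := by
  have : Finite (Polynomial.degreeLT (ZMod 2) (D + 1)) :=
    Finite.of_equiv _ (Polynomial.degreeLTEquiv (ZMod 2) (D + 1)).toEquiv.symm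
  refine (Set.toFinite (Polynomial.degreeLT (ZMod 2) (D + 1) : Set (ZMod 2)[X])).subset ?_
  intro f hf
  exact Polynomial.mem_degreeLT.mpr
    (Polynomial.degree_le_natDegree.trans_lt (by exact_mod_cast Nat.lt_succ_of_le hf))

/-- There are finitely many polynomials of bounded degree, and an ideal divides the principal ideal
generated by its norm. -/
theorem finite_setOf_natDegree_idealNorm_le (D : ℕ) :
    {I : {I : Ideal (OInt K) // I ≠ ⊥} | (idealNorm I.1).natDegree ≤ D}.Finite := by
  have hinj := FunctionField.ringOfIntegers.algebraMap_injective (ZMod 2) K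
  have hfin : ∀ f : (ZMod 2)[X], {I : {I : Ideal (OInt K) // I ≠ ⊥} | idealNorm I.1 = f}.Finite := by
    intro f
    rcases eq_or_ne f 0 with rfl | hf
    · refine Set.Finite.subset Set.finite_empty fun I hI => ?_
      exact (monic_idealNorm I).ne_zero hI
    have hf' : Ideal.span {algebraMap (ZMod 2)[X] (OInt K) f} ≠ 0 := by
      rw [Ideal.zero_eq_bot, Ne, Ideal.span_singleton_eq_bot]
      exact fun h => hf (hinj (h.trans (map_zero _).symm))
    have hdvd : {J | J ∣ Ideal.span {algebraMap (ZMod 2)[X] (OInt K) f}}.Finite :=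
      Set.finite_coe_iff.mp (fintypeSubtypeDvd _ hf').finite
    refine Set.Finite.of_finite_image (f := Subtype.val)
      (hdvd.subset ?_)
      Subtype.val_injective.injOn
    rintro _ ⟨I, rfl, rfl⟩
    exact Ideal.dvd_span_singleton.mpr (algebraMap_idealNorm_mem I)
  refine ((finite_setOf_natDegree_le D).biUnion fun f _ => hfin f).subset fun I hI => ?_
  exact Set.mem_biUnion (x := idealNorm I.1) hI rfl

variable (K) in
theorem summable_zetaTerm {s : SInfty} (hs : 1 < ‖s.x‖) : Summable (zetaTerm K s) := by
  have h0 : 0 ≤ ‖s.x‖⁻¹ := inv_nonneg.mpr (norm_nonneg _)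
  have h1 : ‖s.x‖⁻¹ < 1 := inv_lt_one_of_one_lt₀ hs
  have hn (I : {I : Ideal (OInt K) // I ≠ ⊥}) := norm_gossPow_neg (monic_idealNorm I) s
  refine summable_teichmuller (fun I => ?_) ?_
  · rw [hn]
    exact pow_le_one₀ h0 h1.le
  · simp only [hn]
    refine (tendsto_pow_atTop_nhds_zero_of_lt_one h0 h1).comp (tendsto_atTop.mpr fun D => ?_)
    refine (finite_setOf_natDegree_idealNorm_le (K := K) D).subset fun I hI => ?_
    exact (not_le.mp (show ¬ D ≤ (idealNorm I.1).natDegree from hI)).le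

/-! ### Arithmetic equivalence and equality of zeta functions -/

variable (K) in
/-- The prime of `𝔽₂[T]` below a prime of `𝓞_K`, with the inertia degree. -/
noncomputable def underDeg (v : HeightOneSpectrum (OInt K)) : Ideal (ZMod 2)[X] × ℕ :=
  (v.asIdeal.under (ZMod 2)[X], v.asIdeal.inertiaDeg (ZMod 2)[X])

theorem card_underDeg_fiber {𝔭 : Ideal (ZMod 2)[X]} (hp : 𝔭.IsPrime) (h : 𝔭 ≠ ⊥) (d : ℕ) :
    Finite {v : HeightOneSpectrum (OInt K) // underDeg K v = (𝔭, d)} ∧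
    Nat.card {v : HeightOneSpectrum (OInt K) // underDeg K v = (𝔭, d)} =
      (inertiaDegs K 𝔭).count d := by
  classical
  have := IsPrime.to_maximal_ideal h
  let e : {v : HeightOneSpectrum (OInt K) // underDeg K v = (𝔭, d)} ≃
      {P // P ∈ (IsDedekindDomain.primesOverFinset 𝔭 (OInt K)).filter
        fun P => d = P.inertiaDeg (ZMod 2)[X]} :=
    { toFun := fun v => ⟨v.1.asIdeal, by
        obtain ⟨v, hv⟩ := v
        obtain ⟨h1, h2⟩ := Prod.mk.inj hv
        exact Finset.mem_filter.mpr
          ⟨(IsDedekindDomain.mem_primesOverFinset_iff h _).mpr ⟨v.isPrime, ⟨h1.symm⟩⟩, h2.symm⟩⟩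
      invFun := fun P => by
        have hP := Finset.mem_filter.mp P.2
        have hP' := (IsDedekindDomain.mem_primesOverFinset_iff h _).mp hP.1
        have := hP'.2
        exact ⟨⟨P.1, hP'.1, Ideal.ne_bot_of_liesOver_of_ne_bot h P.1⟩,
          Prod.ext hP'.2.over.symm hP.2.symm⟩
      left_inv := fun _ => rfl
      right_inv := fun _ => rfl }
  refine ⟨Finite.of_equiv _ e.symm, ?_⟩
  rw [Nat.card_congr e, Nat.card_eq_fintype_card, Fintype.card_coe, inertiaDegs,
    Multiset.count_map]
  rfl

/-- Arithmetically equivalent fields have the same number of primes of given inertia degree above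
each prime of `𝔽₂[T]`. -/
theorem exists_equiv_heightOneSpectrum
    (h : ∀ 𝔭 : Ideal (ZMod 2)[X], 𝔭.IsPrime → 𝔭 ≠ ⊥ → inertiaDegs K 𝔭 = inertiaDegs K' 𝔭) :
    ∃ e : HeightOneSpectrum (OInt K) ≃ HeightOneSpectrum (OInt K'),
      ∀ v, underDeg K' (e v) = underDeg K v := by
  have hfib : ∀ b, Nonempty ({v : HeightOneSpectrum (OInt K) // underDeg K v = b} ≃
      {v : HeightOneSpectrum (OInt K') // underDeg K' v = b}) := by
    rintro ⟨𝔭, d⟩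
    by_cases hp : 𝔭.IsPrime ∧ 𝔭 ≠ ⊥
    · obtain ⟨h1, h2⟩ := card_underDeg_fiber (K := K) hp.1 hp.2 d
      obtain ⟨h1', h2'⟩ := card_underDeg_fiber (K := K') hp.1 hp.2 d
      exact Finite.card_eq.mp (by rw [h2, h2', h 𝔭 hp.1 hp.2])
    · have : IsEmpty {v : HeightOneSpectrum (OInt K) // underDeg K v = (𝔭, d)} := by
        refine ⟨fun ⟨v, hv⟩ => hp ?_⟩
        obtain ⟨rfl, -⟩ := Prod.mk.inj hv
        exact ⟨inferInstance, under_ne_bot v⟩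
      have : IsEmpty {v : HeightOneSpectrum (OInt K') // underDeg K' v = (𝔭, d)} := by
        refine ⟨fun ⟨v, hv⟩ => hp ?_⟩
        obtain ⟨rfl, -⟩ := Prod.mk.inj hv
        exact ⟨inferInstance, under_ne_bot v⟩
      exact ⟨Equiv.equivOfIsEmpty _ _⟩
  let e := fun b => (hfib b).some
  refine ⟨(Equiv.sigmaFiberEquiv (underDeg K)).symm.trans
    ((Equiv.sigmaCongrRight e).trans (Equiv.sigmaFiberEquiv (underDeg K'))), fun v => ?_⟩
  exact (e (underDeg K v) ⟨v, rfl⟩).2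

theorem exists_equiv_ideal
    (h : ∀ 𝔭 : Ideal (ZMod 2)[X], 𝔭.IsPrime → 𝔭 ≠ ⊥ → inertiaDegs K 𝔭 = inertiaDegs K' 𝔭) :
    ∃ E : {I : Ideal (OInt K) // I ≠ ⊥} ≃ {I : Ideal (OInt K') // I ≠ ⊥},
      ∀ I, idealNorm (E I).1 = idealNorm I.1 := by
  obtain ⟨e, he⟩ := exists_equiv_heightOneSpectrum K' h
  let M : Multiset (HeightOneSpectrum (OInt K)) ≃ Multiset (HeightOneSpectrum (OInt K')) :=
    { toFun := Multiset.map e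
      invFun := Multiset.map e.symm
      left_inv := fun m => by simp
      right_inv := fun m => by simp }
  refine ⟨((Equiv.ofBijective _ primesProd_bijective).symm.trans M).trans
    (Equiv.ofBijective _ primesProd_bijective), fun I => ?_⟩
  obtain ⟨m, rfl⟩ := (Equiv.ofBijective _ (primesProd_bijective (K := K))).surjective I
  rw [Equiv.trans_apply, Equiv.trans_apply, Equiv.symm_apply_apply]
  change idealNorm (primesProd K' (m.map e)).1 = idealNorm (primesProd K m).1
  rw [idealNorm_primesProd, idealNorm_primesProd, Multiset.map_map]
  congr 1
  refine Multiset.map_congr rfl fun v _ => ?_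
  obtain ⟨h1, h2⟩ := Prod.mk.inj (he v)
  simp only [Function.comp_apply, primeNorm, h1, h2]

theorem liftedGossZeta_eq
    (h : ∀ 𝔭 : Ideal (ZMod 2)[X], 𝔭.IsPrime → 𝔭 ≠ ⊥ → inertiaDegs K 𝔭 = inertiaDegs K' 𝔭)
    (s : SInfty) : liftedGossZeta K s = liftedGossZeta K' s := by
  obtain ⟨E, hE⟩ := exists_equiv_ideal K' h
  rw [liftedGossZeta, liftedGossZeta, ← E.tsum_eq]
  exact tsum_congr fun I => by rw [zetaTerm, zetaTerm, hE]

end Ideals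

/-- Both rings of integers have equally many points in every finite field. -/
theorem inertiaDegs_eq_of_isK {K K' : Type*} [Field K] [Algebra (ZMod 2)[X] K]
    [Algebra (ZMod 2)⟮X⟯ K] [IsScalarTower (ZMod 2)[X] (ZMod 2)⟮X⟯ K] [FunctionField (ZMod 2) K]
    [Algebra.IsSeparable (ZMod 2)⟮X⟯ K] [Field K'] [Algebra (ZMod 2)[X] K']
    [Algebra (ZMod 2)⟮X⟯ K'] [IsScalarTower (ZMod 2)[X] (ZMod 2)⟮X⟯ K']
    [FunctionField (ZMod 2) K'] [Algebra.IsSeparable (ZMod 2)⟮X⟯ K'] {p : ℕ} (hK : IsK K p)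
    (hK' : IsK' K' p) {𝔭 : Ideal (ZMod 2)[X]} (hp : 𝔭.IsPrime) (h : 𝔭 ≠ ⊥) :
    inertiaDegs K 𝔭 = inertiaDegs K' 𝔭 := by
  refine inertiaDegs_eq_of_card_algHom hp h fun B _ _ _ => ?_
  have := charP_two B
  rw [IsArtinSchreierTower.card_algHom hK, IsArtinSchreierTower.card_algHom hK', map_add,
    map_pow _ _ 3, card_towerSolutions_add_cube]

end GossZeta

theorem mainTheorem9 :
    -- an Artin-Schreier extension with integral constant term is unramified at finite places
    (∀ (F K : Type*) [Field F] [Field K] [Algebra (ZMod 2)[X] F] [Algebra (ZMod 2)⟮X⟯ F]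
      [IsScalarTower (ZMod 2)[X] (ZMod 2)⟮X⟯ F] [FunctionField (ZMod 2) F]
      [Algebra.IsSeparable (ZMod 2)⟮X⟯ F] [Algebra (ZMod 2)[X] K] [Algebra F K]
      [IsScalarTower (ZMod 2)[X] F K] (c : F) (a : K),
      IsIntegral (ZMod 2)[X] c → a ^ 2 + a + algebraMap F K c = 0 →
      IntermediateField.adjoin F {a} = ⊤ →
      GossZeta.UnramifiedAtFinitePlaces F K) ∧
    -- and so is a tower of such extensions
    (∀ (F K : Type*) [Field F] [Field K] [Algebra (ZMod 2)[X] F] [Algebra (ZMod 2)⟮X⟯ F]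
      [IsScalarTower (ZMod 2)[X] (ZMod 2)⟮X⟯ F] [FunctionField (ZMod 2) F]
      [Algebra.IsSeparable (ZMod 2)⟮X⟯ F] [Algebra (ZMod 2)[X] K] [Algebra F K]
      [IsScalarTower (ZMod 2)[X] F K] (n : ℕ) (E : ℕ → IntermediateField F K),
      E 0 = ⊥ → E n = ⊤ →
      (∀ i < n, ∃ c ∈ E i, ∃ a : K, IsIntegral (ZMod 2)[X] c ∧ a ^ 2 + a + c = 0 ∧
        E (i + 1) = E i ⊔ IntermediateField.adjoin F {a}) →
      GossZeta.UnramifiedAtFinitePlaces F K) ∧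
    ∀ p : ℕ, p.Prime →
      -- the Galois closure `N(p)` of `K(p)` is unramified at finite places
      (∀ (K N : Type*) [Field K] [Algebra (ZMod 2)[X] K] [Algebra (ZMod 2)⟮X⟯ K]
        [IsScalarTower (ZMod 2)[X] (ZMod 2)⟮X⟯ K] [Field N] [Algebra (ZMod 2)[X] N]
        [Algebra (ZMod 2)⟮X⟯ N] [IsScalarTower (ZMod 2)[X] (ZMod 2)⟮X⟯ N],
        GossZeta.IsK K p → IsNormalClosure (ZMod 2)⟮X⟯ K N →
        IsGalois (ZMod 2)⟮X⟯ N ∧ GossZeta.UnramifiedAtFinitePlaces (ZMod 2)⟮X⟯ N) ∧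
      (∀ (K K' : Type*) [Field K] [Algebra (ZMod 2)[X] K] [Algebra (ZMod 2)⟮X⟯ K]
        [IsScalarTower (ZMod 2)[X] (ZMod 2)⟮X⟯ K] [Field K'] [Algebra (ZMod 2)[X] K']
        [Algebra (ZMod 2)⟮X⟯ K'] [IsScalarTower (ZMod 2)[X] (ZMod 2)⟮X⟯ K'],
        GossZeta.IsK K p → GossZeta.IsK' K' p →
        -- both fields are finite separable over `𝔽₂(T)`
        ∃ (_ : FunctionField (ZMod 2) K) (_ : Algebra.IsSeparable (ZMod 2)⟮X⟯ K)
          (_ : FunctionField (ZMod 2) K') (_ : Algebra.IsSeparable (ZMod 2)⟮X⟯ K'),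
          -- they are arithmetically equivalent with no exceptions
          (∀ 𝔭 : Ideal (ZMod 2)[X], 𝔭.IsPrime → 𝔭 ≠ ⊥ →
            GossZeta.splittingType K 𝔭 = GossZeta.splittingType K' 𝔭) ∧
          -- and their lifted Goss zeta functions converge for `‖x‖ > 1` and agree
          ∀ s : GossZeta.SInfty, 1 < ‖s.x‖ →
            Summable (GossZeta.zetaTerm K s) ∧ Summable (GossZeta.zetaTerm K' s) ∧
            GossZeta.liftedGossZeta K s = GossZeta.liftedGossZeta K' s) := by
  refine ⟨?_, ?_, fun p _ => ⟨?_, ?_⟩⟩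
  · intro F K _ _ _ _ _ _ _ _ _ _ c a hc h ha
    exact GossZeta.unramified_of_artinSchreier hc h ha
  · intro F K _ _ _ _ _ _ _ _ _ _ n E h0 hn h
    exact GossZeta.unramified_of_tower h0 hn h
  · intro K N _ _ _ _ _ _ _ _ hK hN
    exact ⟨GossZeta.IsArtinSchreierTower.isGalois_normalClosure hK hN,
      GossZeta.IsArtinSchreierTower.unramified_normalClosure hK hN⟩
  · intro K K' _ _ _ _ _ _ _ _ hK hK'
    have hfin := GossZeta.IsArtinSchreierTower.finiteDimensional hK
    have hsep := GossZeta.IsArtinSchreierTower.isSeparable hK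
    have hfin' := GossZeta.IsArtinSchreierTower.finiteDimensional hK'
    have hsep' := GossZeta.IsArtinSchreierTower.isSeparable hK'
    have h (𝔭 : Ideal (ZMod 2)[X]) (hp : 𝔭.IsPrime) (h0 : 𝔭 ≠ ⊥) :
        GossZeta.inertiaDegs K 𝔭 = GossZeta.inertiaDegs K' 𝔭 :=
      GossZeta.inertiaDegs_eq_of_isK hK hK' hp h0
    exact ⟨hfin, hsep, hfin', hsep', fun 𝔭 hp h0 => congrArg (Multiset.sort · (· ≤ ·)) (h 𝔭 hp h0),
      fun s hs => ⟨GossZeta.summable_zetaTerm K hs, GossZeta.summable_zetaTerm K' hs,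
        GossZeta.liftedGossZeta_eq K' h s⟩⟩
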